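/- Let $u,v\in\mathbb{R}^D$ be obtained from two nonzero $0/1$-vectors by dividing each by the sum of its entries. Let $a$, $b$, $c$ be the numbers of coordinates $i$ with $u_i>0=v_i$, with $v_i>0=u_i$, and with $u_i,v_i>0$, respectively. Let $r_1,\dots,r_D$ be i.i.d. standard Cauchy, $x=\sum_i u_ir_i$, $y=\sum_i v_ir_i$, let $\rho=\sum_i \frac{2u_iv_i}{u_i+v_i}$ (with $\frac00=0$) and $$P_{\chi^2(2)}=\frac12-\frac{2}{\pi^2}\int_0^{\pi/2}\tan^{-1}\Big(\frac{\rho}{2-2\rho}\tan t\Big)\,dt ,\qquad Err=\Pr(\mathrm{sign}(x)\ne\mathrm{sign}(y))-P_{\chi^2(2)} .$$ For $t_1,t_2\ge 0$ and a standard Cauchy variable $R$ put $$Z(t_1,t_2)=-\frac{2}{\pi^2}E\Big\{\tan^{-1}\Big(\frac{|R|}{t_1}\Big)\tan^{-1}\Big(\frac{|R|}{t_2}\Big)\Big\}+\frac1\pi E\Big\{\tan^{-1}\Big(\frac{|R|}{t_1+t_2}\Big)\Big\}.$$ Here $\tan^{-1}(y/0)=\pi/2$ for $y>0$. Then the equation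 $$\frac{1}{t^2-1}\log\frac{2t}{1+t}-\frac{\log(2t)}{(2t)^2-1}=0$$ has exactly one solution $t^*>0$; $|t^*-2.77935|\le 5\cdot10^{-6}$; for all $t_1,t_2\ge0$, $$0\le Z(t_1,t_2)\le Z(t^*,t^*)=\int_0^\infty\Big\{-\frac{2}{\pi^2}\Big(\tan^{-1}\frac{r}{t^*}\Big)^2+\frac1\pi\tan^{-1}\frac{r}{2t^*}\Big\}\frac{2}{\pi}\frac{1}{1+r^2}\,dr ,$$ so that the maximum of $Z$ is attained at $t_1=t_2=t^*$; and $|Z(t^*,t^*)-0.01919|\le 5\cdot10^{-6}$. For all binary data as above, $0\le Err\le Z(t^*,t^*)$, and $Err=Z(a/c,b/c)$ whenever $c\neq0$. -/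

import Mathlib

open Real MeasureTheory ProbabilityTheory Set

noncomputable section

/-- The value `tan⁻¹ (y / x)` for `0 ≤ y`, `0 ≤ x`, with the usual convention
`tan⁻¹ (y / 0) = tan⁻¹ ∞ = π / 2` for `0 < y` (and `0 / 0 = 0`). -/
def arctanDiv (y x : ℝ) : ℝ :=
  if x = 0 ∧ 0 < y then π / 2 else arctan (y / x)

/-- The law of a standard Cauchy random variable (density `1 / (π (1 + r²))`). -/
abbrev stdCauchy : Measure ℝ := cauchyMeasure 0 1

/-- The data vector `w` is binary (before normalization) and not identically zero. -/
def IsBinaryData {D : ℕ} (w : Fin D → ℝ) : Prop :=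
  (∀ i, w i = 0 ∨ w i = 1) ∧ ∃ i, w i ≠ 0

/-- The sum-to-one normalization of a data vector. -/
def normalizeData {D : ℕ} (w : Fin D → ℝ) : Fin D → ℝ :=
  fun i => w i / ∑ j, w j

/-- The number of coordinates at which the first vector is positive and the second is zero. -/
def onlyFirstCount {D : ℕ} (u v : Fin D → ℝ) : ℕ :=
  {i : Fin D | 0 < u i ∧ v i = 0}.ncard

/-- The number of coordinates at which both vectors are positive. -/
def bothCount {D : ℕ} (u v : Fin D → ℝ) : ℕ :=
  {i : Fin D | 0 < u i ∧ 0 < v i}.ncard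

/-- The collision probability `Pr (sign x ≠ sign y)` for `x = ∑ uᵢ rᵢ`, `y = ∑ vᵢ rᵢ`, where
`r₁, …, r_D` are i.i.d. standard Cauchy. -/
def collisionProb {D : ℕ} (u v : Fin D → ℝ) : ℝ :=
  (Measure.pi fun _ : Fin D => stdCauchy).real
    {r | SignType.sign (∑ i, u i * r i) ≠ SignType.sign (∑ i, v i * r i)}

/-- The chi-square similarity `∑ 2 uᵢ vᵢ / (uᵢ + vᵢ)`, with `0 / 0 = 0`. -/
def chiSqSim {D : ℕ} (u v : Fin D → ℝ) : ℝ :=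
  ∑ i, 2 * u i * v i / (u i + v i)

/-- The second chi-square approximation of the collision probability,
`1/2 - (2/π²) ∫₀^{π/2} tan⁻¹ (ρ / (2 - 2ρ) · tan t) dt`, as a function of the similarity `ρ`.
For `ρ = 1` the arctangent is `tan⁻¹ ∞ = π/2`, so that the value is `0`. -/
def chiSqApprox2 (ρ : ℝ) : ℝ :=
  1 / 2 - 2 / π ^ 2 * ∫ t in (0 : ℝ)..(π / 2), arctanDiv (ρ * tan t) (2 - 2 * ρ)

/-- `Z(t₁, t₂) = -(2/π²) E{tan⁻¹(|R|/t₁) tan⁻¹(|R|/t₂)} + (1/π) E{tan⁻¹(|R|/(t₁+t₂))}` for a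
standard Cauchy variable `R` and `t₁, t₂ ≥ 0`. -/
def errZ (t₁ t₂ : ℝ) : ℝ :=
  -(2 / π ^ 2) * (∫ r, arctanDiv |r| t₁ * arctanDiv |r| t₂ ∂stdCauchy)
    + 1 / π * ∫ r, arctanDiv |r| (t₁ + t₂) ∂stdCauchy

/-- The error of the second chi-square approximation on the data pair `u, v`. -/
def collisionErr {D : ℕ} (u v : Fin D → ℝ) : ℝ :=
  collisionProb u v - chiSqApprox2 (chiSqSim u v)

end

open Filter Topology

/-! Write P(a,b) for the mean of the product of the arccotangents of a/|R| and b/|R| (`arccotProd`).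
The arccotangent of 0 is π/2, so Z(a,b) = (2/π²)(P(a+b,0) − P(a,b)) compares two points of one
antidiagonal (`errZ_eq`). The mixed derivative of P is a rational Cauchy mean, equal to
1/((a+b)(1+a)(1+b)) by partial fractions (`rationalMean_eq_pos`). Integrating it from infinity gives
∂P/∂a = −log((a+b)/(1+b))/(a²−1) (`ratioMean_eq`, `hasDerivAt_arccotProd_left`).

Because log x/(x−1) is decreasing, P decreases along an antidiagonal from the axis to the diagonal.
This gives both Z ≥ 0 and the reduction of the maximum to t₁ = t₂ (`errZ_bounds`). On the diagonal
dZ/dt is 4/π² times the left side of the stated equation (`hasDerivAt_errZ_diag`). Up to a rational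
factor that side is `critNum`, which vanishes at 1/2, at 1 and at one further point t*; the first
two zeros are cancelled by the factor. The sign pattern of `critNum` then gives uniqueness of the
root and maximality at t*.

For the numerical value, P(t,t) is π²/12 minus a dilogarithm integral in (t−1)/(t+1), and P(s,0) has
an expansion in powers of 1/s. Both are enclosed between explicit partial sums (`errZ_lower`,
`errZ_upper`).

For binary data, characteristic functions show that, up to positive scaling, (x, y) has the law of
(aR₁+cR₀, bR₂+cR₀) with independent Cauchy variables (`map_pi_stdCauchy_eq`). Conditioning on R₀
makes the signs independent with arctangent means, and the substitution t = arctan r turns the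
approximation into a Cauchy mean as well; the difference is Z(a/c, b/c). -/

theorem stdCauchy_eq : stdCauchy = volume.withDensity (cauchyPDF 0 1) :=
  cauchyMeasure_of_scale_ne_zero 0 one_ne_zero

theorem integral_stdCauchy {E : Type*} [NormedAddCommGroup E] [NormedSpace ℝ E] (f : ℝ → E) :
    ∫ x, f x ∂stdCauchy = ∫ x, (π⁻¹ * (1 + x ^ 2)⁻¹) • f x := by
  rw [stdCauchy_eq, integral_withDensity_eq_integral_toReal_smul (by fun_prop)
    (Eventually.of_forall fun x => by simp [cauchyPDF])]
  refine integral_congr_ae (Eventually.of_forall fun x => ?_)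
  have h : 0 ≤ cauchyPDFReal 0 1 x := (cauchyPDF_pos 0 one_ne_zero x).le
  simp only [cauchyPDF, ENNReal.toReal_ofReal h]
  simp [cauchyPDFReal, add_comm]

instance : NullSingletonClass stdCauchy := by
  rw [stdCauchy_eq]; infer_instance

theorem ae_stdCauchy_ne (x : ℝ) : ∀ᵐ r ∂stdCauchy, r ≠ x := by
  rw [ae_iff]; simp

theorem integral_stdCauchy_abs (f : ℝ → ℝ) :
    ∫ x, f |x| ∂stdCauchy = ∫ x in Ioi (0 : ℝ), f x * (2 / π * (1 / (1 + x ^ 2))) := by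
  rw [integral_stdCauchy]
  have := integral_comp_abs (f := fun x => (π⁻¹ * (1 + x ^ 2)⁻¹) * f x)
  simp only [sq_abs] at this
  simp only [smul_eq_mul]
  rw [this, ← integral_const_mul]
  congr 1; ext x; ring

theorem integrable_stdCauchy_of_bounded {f : ℝ → ℝ} (C : ℝ) (hf : Measurable f)
    (h : ∀ x, |f x| ≤ C) : Integrable f stdCauchy :=
  Integrable.of_bound hf.aestronglyMeasurable C (Eventually.of_forall h)

/-! ### Arccotangents and the mean of their product -/

/-- `tan⁻¹ (|r| / t)` in the form `π / 2 - tan⁻¹ (t / |r|)`, which is smooth in `t`. -/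
noncomputable def arccotAbs (t r : ℝ) : ℝ := π / 2 - arctan (t / |r|)

theorem arctanDiv_eq_arccotAbs {t r : ℝ} (ht : 0 ≤ t) (hr : r ≠ 0) :
    arctanDiv |r| t = arccotAbs t r := by
  have h := abs_pos.2 hr
  unfold arctanDiv arccotAbs
  rcases ht.eq_or_lt with rfl | ht
  · simp [hr]
  · rw [if_neg (by simp [ht.ne']), ← inv_div, arctan_inv_of_pos (by positivity)]

@[fun_prop]
theorem measurable_arccotAbs (t : ℝ) : Measurable (arccotAbs t) := by
  unfold arccotAbs; fun_prop

theorem arccotAbs_nonneg (t r : ℝ) : 0 ≤ arccotAbs t r := by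
  have := arctan_lt_pi_div_two (t / |r|); unfold arccotAbs; linarith

theorem arccotAbs_le_pi (t r : ℝ) : arccotAbs t r ≤ π := by
  have := neg_pi_div_two_lt_arctan (t / |r|); unfold arccotAbs; linarith

theorem abs_arccotAbs_le (t r : ℝ) : |arccotAbs t r| ≤ π := by
  rw [abs_of_nonneg (arccotAbs_nonneg t r)]; exact arccotAbs_le_pi t r

theorem arccotAbs_zero (r : ℝ) : arccotAbs 0 r = π / 2 := by simp [arccotAbs]

theorem continuous_arccotAbs (r : ℝ) : Continuous fun t => arccotAbs t r := by
  unfold arccotAbs; fun_prop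

theorem tendsto_arccotAbs {r : ℝ} (hr : r ≠ 0) :
    Tendsto (fun t => arccotAbs t r) atTop (𝓝 0) := by
  have h1 : Tendsto (fun t : ℝ => t / |r|) atTop atTop :=
    tendsto_id.atTop_div_const (abs_pos.2 hr)
  have h2 := ((tendsto_nhds_of_tendsto_nhdsWithin tendsto_arctan_atTop).comp h1).const_sub (π / 2)
  simpa [arccotAbs] using h2

theorem hasDerivAt_arccotAbs {r : ℝ} (hr : r ≠ 0) (t : ℝ) :
    HasDerivAt (fun t => arccotAbs t r) (-(|r| / (r ^ 2 + t ^ 2))) t := by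
  have h := (((hasDerivAt_id t).div_const |r|).arctan).const_sub (π / 2)
  have h0 := abs_pos.2 hr
  refine h.congr_deriv ?_
  simp only [id]
  rw [← sq_abs r]
  field_simp

/-- `E {tan⁻¹ (|R| / a) tan⁻¹ (|R| / b)}`. -/
noncomputable def arccotProd (a b : ℝ) : ℝ := ∫ r, arccotAbs a r * arccotAbs b r ∂stdCauchy

theorem arccotProd_comm (a b : ℝ) : arccotProd a b = arccotProd b a := by
  simp only [arccotProd, mul_comm]

theorem abs_arccotAbs_mul_le (a b r : ℝ) : |arccotAbs a r * arccotAbs b r| ≤ π * π := by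
  rw [abs_mul]
  exact mul_le_mul (abs_arccotAbs_le a r) (abs_arccotAbs_le b r) (abs_nonneg _) pi_pos.le

theorem continuous_arccotProd : Continuous fun p : ℝ × ℝ => arccotProd p.1 p.2 := by
  unfold arccotProd
  refine continuous_of_dominated (bound := fun _ => π * π) (fun p => ?_)
    (fun p => Eventually.of_forall fun r => abs_arccotAbs_mul_le _ _ r) (integrable_const _)
    (Eventually.of_forall fun r => ?_)
  · exact (by fun_prop : Measurable _).aestronglyMeasurable
  · exact ((continuous_arccotAbs r).comp continuous_fst).mul
      ((continuous_arccotAbs r).comp continuous_snd)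

theorem tendsto_arccotProd_atTop (b : ℝ) :
    Tendsto (fun a => arccotProd a b) atTop (𝓝 0) := by
  unfold arccotProd
  rw [show (0 : ℝ) = ∫ r, 0 * arccotAbs b r ∂stdCauchy by simp]
  refine tendsto_integral_filter_of_dominated_convergence (fun _ => π * π)
    (Eventually.of_forall fun a => (by fun_prop : Measurable _).aestronglyMeasurable)
    (Eventually.of_forall fun a => Eventually.of_forall fun r => abs_arccotAbs_mul_le _ _ r)
    (integrable_const _) ?_
  filter_upwards [ae_stdCauchy_ne 0] with r hr
  exact (tendsto_arccotAbs hr).mul_const _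

/-- The factor `arccotAbs 0` is the constant π/2, so the single arctangent is also a product mean,
with second argument 0. The point r = 0, where the conventions differ, is null. -/
theorem errZ_eq {a b : ℝ} (ha : 0 ≤ a) (hb : 0 ≤ b) :
    errZ a b = -(2 / π ^ 2) * (arccotProd a b - arccotProd (a + b) 0) := by
  have h1 : ∫ r, arctanDiv |r| a * arctanDiv |r| b ∂stdCauchy = arccotProd a b := by
    refine integral_congr_ae ?_
    filter_upwards [ae_stdCauchy_ne 0] with r hr
    rw [arctanDiv_eq_arccotAbs ha hr, arctanDiv_eq_arccotAbs hb hr]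
  have h2 : ∫ r, arctanDiv |r| (a + b) ∂stdCauchy = 2 / π * arccotProd (a + b) 0 := by
    unfold arccotProd
    rw [← integral_const_mul]
    refine integral_congr_ae ?_
    filter_upwards [ae_stdCauchy_ne 0] with r hr
    rw [arctanDiv_eq_arccotAbs (add_nonneg ha hb) hr, arccotAbs_zero]
    field_simp
  rw [errZ, h1, h2]
  ring

/-! ### The mixed second derivative -/

theorem rational_bound {a : ℝ} (ha : 0 < a) (b r : ℝ) :
    |r ^ 2 / ((r ^ 2 + a ^ 2) * (r ^ 2 + b ^ 2))| ≤ 1 / a ^ 2 := by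
  rw [abs_of_nonneg (by positivity)]
  rcases eq_or_ne r 0 with rfl | hr
  · simp; positivity
  · rw [div_le_div_iff₀ (by positivity) (by positivity)]
    nlinarith [mul_nonneg (sq_nonneg r) (sq_nonneg r), mul_nonneg (sq_nonneg r) (sq_nonneg b),
      mul_nonneg (sq_nonneg a) (sq_nonneg b)]

/-- `E {R² / ((R² + a²) (R² + b²))}`. -/
noncomputable def rationalMean (a b : ℝ) : ℝ :=
  ∫ r, r ^ 2 / ((r ^ 2 + a ^ 2) * (r ^ 2 + b ^ 2)) ∂stdCauchy

theorem rationalMean_comm (a b : ℝ) : rationalMean a b = rationalMean b a := by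
  simp only [rationalMean, mul_comm]

theorem continuous_rationalMean {a : ℝ} (ha : 0 < a) : Continuous fun b => rationalMean a b := by
  unfold rationalMean
  refine continuous_of_dominated (bound := fun _ => 1 / a ^ 2) (fun b => ?_)
    (fun b => Eventually.of_forall fun r => rational_bound ha b r) (integrable_const _) ?_
  · exact (by fun_prop : Measurable _).aestronglyMeasurable
  · filter_upwards [ae_stdCauchy_ne 0] with r hr
    exact continuous_const.div (by fun_prop) fun b => by positivity

theorem hasDerivAt_arctan_div {a : ℝ} (ha : 0 < a) (r : ℝ) :
    HasDerivAt (fun r => arctan (r / a)) (a / (r ^ 2 + a ^ 2)) r := by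
  refine (((hasDerivAt_id r).div_const a).arctan).congr_deriv ?_
  simp only [id]
  field_simp
  ring

theorem tendsto_arctan_div_atTop {a : ℝ} (ha : 0 < a) :
    Tendsto (fun r => arctan (r / a)) atTop (𝓝 (π / 2)) :=
  (tendsto_nhds_of_tendsto_nhdsWithin tendsto_arctan_atTop).comp (tendsto_id.atTop_div_const ha)

theorem tendsto_arctan_div_atBot {a : ℝ} (ha : 0 < a) :
    Tendsto (fun r => arctan (r / a)) atBot (𝓝 (-(π / 2))) :=
  (tendsto_nhds_of_tendsto_nhdsWithin tendsto_arctan_atBot).comp (tendsto_id.atBot_div_const ha)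

theorem rationalMean_of_ne {a b : ℝ} (ha : 0 < a) (hb : 0 < b) (ha1 : a ≠ 1) (hb1 : b ≠ 1)
    (hab : a ≠ b) : rationalMean a b = 1 / ((a + b) * (1 + a) * (1 + b)) := by
  have e1 : a ^ 2 - 1 ≠ 0 := fun h => ha1 (by nlinarith)
  have e2 : b ^ 2 - 1 ≠ 0 := fun h => hb1 (by nlinarith)
  have e3 : a ^ 2 - b ^ 2 ≠ 0 := fun h => hab (by nlinarith)
  have f1 : a - 1 ≠ 0 := sub_ne_zero.2 ha1
  have f2 : b - 1 ≠ 0 := sub_ne_zero.2 hb1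
  have f3 : a - b ≠ 0 := sub_ne_zero.2 hab
  -- Partial fraction coefficients of r²/((r²+1)(r²+a²)(r²+b²)), with the factors a and b of the
  -- arctangent derivatives divided out.
  set α := -a / ((a ^ 2 - b ^ 2) * (a ^ 2 - 1)) with hα
  set β := b / ((a ^ 2 - b ^ 2) * (b ^ 2 - 1)) with hβ
  set γ := -1 / ((a ^ 2 - 1) * (b ^ 2 - 1)) with hγ
  let f : ℝ → ℝ := fun r =>
    π⁻¹ * (α * arctan (r / a) + β * arctan (r / b) + γ * arctan (r / 1))
  have hd : ∀ r, HasDerivAt f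
      ((π⁻¹ * (1 + r ^ 2)⁻¹) * (r ^ 2 / ((r ^ 2 + a ^ 2) * (r ^ 2 + b ^ 2)))) r := by
    intro r
    refine ((((hasDerivAt_arctan_div ha r).const_mul α).add
      ((hasDerivAt_arctan_div hb r).const_mul β)).add
      ((hasDerivAt_arctan_div one_pos r).const_mul γ)).const_mul π⁻¹ |>.congr_deriv ?_
    have g1 : r ^ 2 + a ^ 2 ≠ 0 := by positivity
    have g2 : r ^ 2 + b ^ 2 ≠ 0 := by positivity
    have g3 : r ^ 2 + 1 ^ 2 ≠ 0 := by positivity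
    have g4 : 1 + r ^ 2 ≠ 0 := by positivity
    rw [mul_assoc]
    congr 1
    rw [hα, hβ, hγ]
    field_simp
    ring
  have hint : Integrable fun r : ℝ =>
      (π⁻¹ * (1 + r ^ 2)⁻¹) * (r ^ 2 / ((r ^ 2 + a ^ 2) * (r ^ 2 + b ^ 2))) := by
    refine (integrable_inv_one_add_sq.const_mul π⁻¹).mul_bdd (c := 1 / a ^ 2)
      (by fun_prop : Measurable _).aestronglyMeasurable
      (Eventually.of_forall fun r => rational_bound ha b r)
  have htop : Tendsto f atTop (𝓝 (π⁻¹ * (α * (π / 2) + β * (π / 2) + γ * (π / 2)))) :=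
    ((((tendsto_arctan_div_atTop ha).const_mul α).add
      ((tendsto_arctan_div_atTop hb).const_mul β)).add
      ((tendsto_arctan_div_atTop one_pos).const_mul γ)).const_mul π⁻¹
  have hbot : Tendsto f atBot
      (𝓝 (π⁻¹ * (α * (-(π / 2)) + β * (-(π / 2)) + γ * (-(π / 2))))) :=
    ((((tendsto_arctan_div_atBot ha).const_mul α).add
      ((tendsto_arctan_div_atBot hb).const_mul β)).add
      ((tendsto_arctan_div_atBot one_pos).const_mul γ)).const_mul π⁻¹
  have := integral_of_hasDerivAt_of_tendsto hd hint hbot htop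
  rw [rationalMean, integral_stdCauchy]
  simp only [smul_eq_mul]
  rw [this]
  have : π⁻¹ * (α * (π / 2) + β * (π / 2) + γ * (π / 2)) -
      π⁻¹ * (α * (-(π / 2)) + β * (-(π / 2)) + γ * (-(π / 2))) = α + β + γ := by
    field_simp
    ring
  rw [this, hα, hβ, hγ]
  have e1' : a ^ 2 - 1 = (a - 1) * (1 + a) := by ring
  have e2' : b ^ 2 - 1 = (b - 1) * (1 + b) := by ring
  have e3' : a ^ 2 - b ^ 2 = (a - b) * (a + b) := by ring
  rw [e1', e2', e3']
  field_simp
  ring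

theorem eq_at_of_eventuallyEq_punctured {f g : ℝ → ℝ} {x : ℝ} (hf : ContinuousAt f x)
    (hg : ContinuousAt g x) (h : f =ᶠ[𝓝[≠] x] g) : f x = g x :=
  ((hf.eventuallyEq_nhds_iff_eventuallyEq_nhdsNE hg).1 h).eq_of_nhds

theorem eventually_punctured_generic {x : ℝ} (hx : 0 < x) (c : ℝ) :
    ∀ᶠ y in 𝓝[≠] x, 0 < y ∧ y ≠ 1 ∧ y ≠ c := by
  have h : ∀ c : ℝ, ∀ᶠ y in 𝓝[≠] x, y ≠ c := by
    intro c
    rcases eq_or_ne x c with rfl | hc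
    · exact self_mem_nhdsWithin
    · exact nhdsWithin_le_nhds (eventually_ne_nhds hc)
  filter_upwards [nhdsWithin_le_nhds (lt_mem_nhds hx), h 1, h c] with y h1 h2 h3
  exact ⟨h1, h2, h3⟩

/-- Both sides are continuous in each variable, so the exceptional values a = 1, b = 1 and a = b of
the partial fractions are filled in by punctured limits, first in b and then in a. -/
theorem rationalMean_eq_pos {a b : ℝ} (ha : 0 < a) (hb : 0 < b) :
    rationalMean a b = 1 / ((a + b) * (1 + a) * (1 + b)) := by
  have step : ∀ {a b : ℝ}, 0 < a → 0 < b → a ≠ 1 →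
      rationalMean a b = 1 / ((a + b) * (1 + a) * (1 + b)) := by
    intro a b ha hb ha1
    refine eq_at_of_eventuallyEq_punctured (f := fun b => rationalMean a b)
      (g := fun b => 1 / ((a + b) * (1 + a) * (1 + b))) (continuous_rationalMean ha).continuousAt
      (continuousAt_const.div (by fun_prop) (by positivity)) ?_
    filter_upwards [eventually_punctured_generic hb a] with y hy
    exact rationalMean_of_ne ha hy.1 ha1 hy.2.1 hy.2.2.symm
  refine eq_at_of_eventuallyEq_punctured (f := fun a => rationalMean a b)
    (g := fun a => 1 / ((a + b) * (1 + a) * (1 + b))) ?_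
    (continuousAt_const.div (by fun_prop) (by positivity)) ?_
  · simp only [rationalMean_comm _ b]
    exact (continuous_rationalMean hb).continuousAt
  · filter_upwards [eventually_punctured_generic ha 1] with y hy
    exact step hy.1 hb hy.2.1

/-! ### Closed form of the first derivative -/

/-- `log x / (x - 1)`, extended continuously to `x = 1`. -/
noncomputable def logSlope (x : ℝ) : ℝ := if x = 1 then 1 else log x / (x - 1)

theorem logSlope_one : logSlope 1 = 1 := if_pos rfl

theorem logSlope_of_ne {x : ℝ} (hx : x ≠ 1) : logSlope x = log x / (x - 1) := if_neg hx

theorem logSlope_le_one {x : ℝ} (hx : 1 ≤ x) : logSlope x ≤ 1 := by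
  rcases hx.eq_or_lt with rfl | h
  · exact logSlope_one.le
  · rw [logSlope_of_ne h.ne', div_le_one (by linarith)]
    exact log_le_sub_one_of_pos (by linarith)

theorem one_le_logSlope {x : ℝ} (h0 : 0 < x) (hx : x ≤ 1) : 1 ≤ logSlope x := by
  rcases hx.eq_or_lt with rfl | h
  · exact logSlope_one.ge
  · rw [logSlope_of_ne h.ne, le_div_iff_of_neg (by linarith), one_mul]
    exact log_le_sub_one_of_pos h0

/-- This is the slope of the secant of log from 1 to x, and secant slopes of a concave function
decrease; the base point 1 itself is handled through log x ≤ x − 1. -/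
theorem logSlope_anti {x y : ℝ} (hx : 0 < x) (hxy : x ≤ y) : logSlope y ≤ logSlope x := by
  rcases le_total x 1 with h1 | h1
  · rcases le_total 1 y with h2 | h2
    · exact (logSlope_le_one h2).trans (one_le_logSlope hx h1)
    · rcases h2.eq_or_lt with rfl | h2
      · rw [logSlope_one]; exact one_le_logSlope hx h1
      rcases hxy.eq_or_lt with rfl | hxy
      · rfl
      rw [logSlope_of_ne h2.ne, logSlope_of_ne (hxy.trans h2).ne]
      have := strictConcaveOn_log_Ioi.concaveOn.neg.secant_mono (a := 1) (x := x) (y := y)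
        (by simp) (by simpa using hx) (by simpa using hx.trans hxy) (hxy.trans h2).ne h2.ne hxy.le
      simp only [Pi.neg_apply, log_one, neg_zero, sub_zero, neg_div] at this
      linarith
  · rcases h1.eq_or_lt with rfl | h1
    · rw [logSlope_one]; exact logSlope_le_one hxy
    have h2 := h1.trans_le hxy
    rw [logSlope_of_ne h2.ne', logSlope_of_ne h1.ne']
    have := strictConcaveOn_log_Ioi.concaveOn.neg.secant_mono (a := 1) (x := x) (y := y)
      (by simp) (by simpa using hx) (by simpa using hx.trans_le hxy) h1.ne' h2.ne' hxy
    simp only [Pi.neg_apply, log_one, neg_zero, sub_zero, neg_div] at this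
    linarith

/-- `E {|R| / (R² + a²) tan⁻¹ (|R| / b)}`. -/
noncomputable def ratioMean (a b : ℝ) : ℝ :=
  ∫ r, |r| / (r ^ 2 + a ^ 2) * arccotAbs b r ∂stdCauchy

theorem abs_ratio_le {a : ℝ} (ha : 0 < a) (r : ℝ) : |(|r| / (r ^ 2 + a ^ 2))| ≤ 1 / a := by
  rw [abs_of_nonneg (by positivity), div_le_div_iff₀ (by positivity) ha, ← sq_abs r]
  nlinarith [sq_nonneg (|r| - a), abs_nonneg r]

theorem abs_ratio_mul_le {a : ℝ} (ha : 0 < a) (b r : ℝ) :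
    |(|r| / (r ^ 2 + a ^ 2) * arccotAbs b r)| ≤ 1 / a * π := by
  rw [abs_mul]
  exact mul_le_mul (abs_ratio_le ha r) (abs_arccotAbs_le b r) (abs_nonneg _) (by positivity)

theorem continuous_ratioMean {a : ℝ} (ha : 0 < a) : Continuous fun b => ratioMean a b := by
  unfold ratioMean
  refine continuous_of_dominated (bound := fun _ => 1 / a * π) (fun b => ?_)
    (fun b => Eventually.of_forall fun r => abs_ratio_mul_le ha b r) (integrable_const _)
    (Eventually.of_forall fun r => ?_)
  · exact (by fun_prop : Measurable _).aestronglyMeasurable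
  · exact continuous_const.mul (continuous_arccotAbs r)

theorem tendsto_ratioMean {a : ℝ} (ha : 0 < a) :
    Tendsto (fun b => ratioMean a b) atTop (𝓝 0) := by
  unfold ratioMean
  rw [show (0 : ℝ) = ∫ r, |r| / (r ^ 2 + a ^ 2) * 0 ∂stdCauchy by simp]
  refine tendsto_integral_filter_of_dominated_convergence (fun _ => 1 / a * π)
    (Eventually.of_forall fun b => (by fun_prop : Measurable _).aestronglyMeasurable)
    (Eventually.of_forall fun b => Eventually.of_forall fun r => abs_ratio_mul_le ha b r)
    (integrable_const _) ?_
  filter_upwards [ae_stdCauchy_ne 0] with r hr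
  exact (tendsto_arccotAbs hr).const_mul _

theorem hasDerivAt_ratioMean {a b : ℝ} (ha : 0 < a) (hb : 0 < b) :
    HasDerivAt (fun b => ratioMean a b) (-(1 / ((a + b) * (1 + a) * (1 + b)))) b := by
  rw [← rationalMean_eq_pos ha hb, rationalMean, ← integral_neg]
  refine (hasDerivAt_integral_of_dominated_loc_of_deriv_le (s := univ)
    (bound := fun _ => 1 / a ^ 2)
    (F' := fun b r => -(r ^ 2 / ((r ^ 2 + a ^ 2) * (r ^ 2 + b ^ 2)))) univ_mem
    (Eventually.of_forall fun b => (by fun_prop : Measurable _).aestronglyMeasurable)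
    (integrable_stdCauchy_of_bounded (1 / a * π) (by fun_prop) (abs_ratio_mul_le ha b))
    (by fun_prop : Measurable _).aestronglyMeasurable
    (Eventually.of_forall fun r b _ => ?_) (integrable_const _) ?_).2
  · rw [norm_neg]; exact rational_bound ha b r
  · filter_upwards [ae_stdCauchy_ne 0] with r hr b _
    refine ((hasDerivAt_arccotAbs hr b).const_mul _).congr_deriv ?_
    have : r ^ 2 + b ^ 2 ≠ 0 := by positivity
    rw [← sq_abs r] at *
    field_simp

/-- The closed form of `ratioMean`. -/
noncomputable def ratioClosed (a b : ℝ) : ℝ :=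
  logSlope ((a + b) / (1 + b)) / ((1 + a) * (1 + b))

theorem ratioClosed_one {b : ℝ} (hb : 0 ≤ b) : ratioClosed 1 b = 1 / (2 * (1 + b)) := by
  rw [ratioClosed, div_self (by positivity), logSlope_one]; norm_num

theorem ratioClosed_of_ne {a b : ℝ} (ha1 : a ≠ 1) (ha : 0 < a) (hb : 0 ≤ b) :
    ratioClosed a b = log ((a + b) / (1 + b)) / (a ^ 2 - 1) := by
  have h1 : 1 + b ≠ 0 := by positivity
  have h2 : 1 + a ≠ 0 := by positivity
  have f1 : a - 1 ≠ 0 := sub_ne_zero.2 ha1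
  have h : (a + b) / (1 + b) - 1 = (a - 1) / (1 + b) := by field_simp; ring
  have h3 : (a + b) / (1 + b) ≠ 1 := by
    rw [← sub_ne_zero, h]; exact div_ne_zero f1 h1
  rw [ratioClosed, logSlope_of_ne h3, h, show a ^ 2 - 1 = (a - 1) * (1 + a) by ring]
  field_simp

theorem hasDerivAt_ratioClosed {a b : ℝ} (ha : 0 < a) (hb : 0 < b) :
    HasDerivAt (fun b => ratioClosed a b) (-(1 / ((a + b) * (1 + a) * (1 + b)))) b := by
  have hev : ∀ᶠ x in 𝓝 b, 0 < x := lt_mem_nhds hb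
  rcases eq_or_ne a 1 with rfl | ha1
  · have h : HasDerivAt (fun b : ℝ => 1 / (2 * (1 + b))) (-(1 / ((1 + b) * (1 + 1) * (1 + b)))) b := by
      refine ((hasDerivAt_const b (1 : ℝ)).div
        (((hasDerivAt_id b).const_add 1).const_mul 2) (by simp; positivity)).congr_deriv ?_
      simp only [id]
      field_simp
      norm_num
    refine h.congr_of_eventuallyEq ?_
    filter_upwards [hev] with x hx using ratioClosed_one hx.le
  · have f1 : a - 1 ≠ 0 := sub_ne_zero.2 ha1
    have h : HasDerivAt (fun b : ℝ => log ((a + b) / (1 + b)) / (a ^ 2 - 1))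
        (-(1 / ((a + b) * (1 + a) * (1 + b)))) b := by
      refine (((((hasDerivAt_id b).const_add a).div ((hasDerivAt_id b).const_add 1)
        (by simp; positivity)).log (by simp; constructor <;> positivity)).div_const
        (a ^ 2 - 1)).congr_deriv ?_
      simp only [id, Pi.div_apply]
      rw [show a ^ 2 - 1 = (a - 1) * (1 + a) by ring]
      have : a + b ≠ 0 := by positivity
      have : 1 + b ≠ 0 := by positivity
      have : 1 + a ≠ 0 := by positivity
      field_simp
      ring
    refine h.congr_of_eventuallyEq ?_
    filter_upwards [hev] with x hx using ratioClosed_of_ne ha1 ha hx.le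

theorem tendsto_add_div_add (a : ℝ) :
    Tendsto (fun b : ℝ => (a + b) / (1 + b)) atTop (𝓝 1) := by
  have h : Tendsto (fun b : ℝ => 1 + (a - 1) / (1 + b)) atTop (𝓝 (1 + 0)) :=
    (tendsto_const_nhds.div_atTop (tendsto_atTop_add_const_left _ 1 tendsto_id)).const_add 1
  rw [add_zero] at h
  refine h.congr' ?_
  filter_upwards [eventually_gt_atTop 0] with b hb
  field_simp
  ring

theorem tendsto_ratioClosed {a : ℝ} (ha : 0 < a) :
    Tendsto (fun b => ratioClosed a b) atTop (𝓝 0) := by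
  rcases eq_or_ne a 1 with rfl | ha1
  · have h : Tendsto (fun b : ℝ => 1 / (2 * (1 + b))) atTop (𝓝 0) :=
      tendsto_const_nhds.div_atTop
        ((tendsto_atTop_add_const_left _ 1 tendsto_id).const_mul_atTop two_pos)
    refine h.congr' ?_
    filter_upwards [eventually_ge_atTop 0] with x hx using (ratioClosed_one hx).symm
  · have h : Tendsto (fun b : ℝ => log ((a + b) / (1 + b)) / (a ^ 2 - 1)) atTop
        (𝓝 (log 1 / (a ^ 2 - 1))) := ((tendsto_add_div_add a).log one_ne_zero).div_const _
    rw [log_one, zero_div] at h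
    refine h.congr' ?_
    filter_upwards [eventually_ge_atTop 0] with x hx using (ratioClosed_of_ne ha1 ha hx).symm

/-- One-sided continuity brings in the boundary value b = 0, where the derivative in b is not
available. -/
theorem continuousWithinAt_ratioClosed {a b : ℝ} (ha : 0 < a) (hb : 0 ≤ b) :
    ContinuousWithinAt (fun b => ratioClosed a b) (Ici b) b := by
  rcases eq_or_ne a 1 with rfl | ha1
  · have h : ContinuousWithinAt (fun b : ℝ => 1 / (2 * (1 + b))) (Ici b) b :=
      (continuousAt_const.div (by fun_prop) (by positivity)).continuousWithinAt
    exact h.congr (fun x hx => ratioClosed_one (hb.trans hx)) (ratioClosed_one hb)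
  · have h : ContinuousWithinAt (fun b : ℝ => log ((a + b) / (1 + b)) / (a ^ 2 - 1)) (Ici b) b := by
      have h1 : 1 + b ≠ 0 := by positivity
      have h2 : (a + b) / (1 + b) ≠ 0 := by positivity
      have h3 : ContinuousAt (fun b : ℝ => (a + b) / (1 + b)) b := by fun_prop (disch := exact h1)
      exact ((h3.log h2).div_const _).continuousWithinAt
    exact h.congr (fun x hx => ratioClosed_of_ne ha1 ha (hb.trans hx)) (ratioClosed_of_ne ha1 ha hb)

/-- Both functions of b have the same derivative on (b, ∞) and tend to 0, so each equals minus the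
same improper integral. -/
theorem ratioMean_eq {a b : ℝ} (ha : 0 < a) (hb : 0 ≤ b) : ratioMean a b = ratioClosed a b := by
  have hneg : ∀ x ∈ Ioi b, -(1 / ((a + x) * (1 + a) * (1 + x))) ≤ 0 := by
    intro x hx
    have : 0 < x := hb.trans_lt hx
    rw [neg_nonpos]
    positivity
  have h1 := integral_Ioi_of_hasDerivAt_of_nonpos (continuous_ratioMean ha).continuousWithinAt
    (fun x hx => hasDerivAt_ratioMean ha (hb.trans_lt hx)) hneg (tendsto_ratioMean ha)
  have h2 := integral_Ioi_of_hasDerivAt_of_nonpos (continuousWithinAt_ratioClosed ha hb)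
    (fun x hx => hasDerivAt_ratioClosed ha (hb.trans_lt hx)) hneg (tendsto_ratioClosed ha)
  linarith

/-! ### Derivatives of the product mean and reduction to the diagonal -/

theorem integrable_ratio_mul {a : ℝ} (ha : 0 < a) (b : ℝ) :
    Integrable (fun r => |r| / (r ^ 2 + a ^ 2) * arccotAbs b r) stdCauchy :=
  integrable_stdCauchy_of_bounded (1 / a * π) (by fun_prop) (abs_ratio_mul_le ha b)

theorem hasDerivAt_arccotProd_left {a b : ℝ} (ha : 0 < a) (hb : 0 ≤ b) :
    HasDerivAt (fun a => arccotProd a b) (-ratioClosed a b) a := by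
  rw [← ratioMean_eq ha hb, ratioMean, ← integral_neg]
  -- Staying above a/2 keeps the derivative of the integrand bounded uniformly in r.
  refine (hasDerivAt_integral_of_dominated_loc_of_deriv_le (s := Ioi (a / 2))
    (bound := fun _ => 1 / (a / 2) * π)
    (F' := fun a r => -(|r| / (r ^ 2 + a ^ 2) * arccotAbs b r)) (Ioi_mem_nhds (half_lt_self ha))
    (Eventually.of_forall fun b => (by fun_prop : Measurable _).aestronglyMeasurable)
    (integrable_stdCauchy_of_bounded (π * π) (by fun_prop) (abs_arccotAbs_mul_le a b))
    (by fun_prop : Measurable _).aestronglyMeasurable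
    (Eventually.of_forall fun r x hx => ?_) (integrable_const _) ?_).2
  · rw [norm_neg]
    have hx' : a / 2 < x := hx
    have h0 : 0 < a / 2 := half_pos ha
    refine (abs_ratio_mul_le (h0.trans hx') b r).trans ?_
    gcongr
  · filter_upwards [ae_stdCauchy_ne 0] with r hr x _
    exact ((hasDerivAt_arccotAbs hr x).mul_const _).congr_deriv (by ring)

/-- The derivative of `arccotProd` along a line through a point of the open quadrant. -/
theorem hasDerivAt_arccotProd_line {p q ε δ : ℝ} {t : ℝ} (hp : 0 < p + ε * t)
    (hq : 0 < q + δ * t) :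
    HasDerivAt (fun t => arccotProd (p + ε * t) (q + δ * t))
      (-(ε * ratioClosed (p + ε * t) (q + δ * t) + δ * ratioClosed (q + δ * t) (p + ε * t))) t := by
  set a := p + ε * t with ha
  set b := q + δ * t with hb
  have key : ∫ r, -(ε * (|r| / (r ^ 2 + a ^ 2) * arccotAbs b r) +
      δ * (|r| / (r ^ 2 + b ^ 2) * arccotAbs a r)) ∂stdCauchy =
      -(ε * ratioClosed a b + δ * ratioClosed b a) := by
    rw [integral_neg, integral_add ((integrable_ratio_mul hp b).const_mul ε)
      ((integrable_ratio_mul hq a).const_mul δ), integral_const_mul, integral_const_mul,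
      ← ratioMean_eq hp hq.le, ← ratioMean_eq hq hp.le, ratioMean, ratioMean]
  rw [← key]
  have hU : {x : ℝ | a / 2 < p + ε * x ∧ b / 2 < q + δ * x} ∈ 𝓝 t := by
    have h1 : Tendsto (fun x => p + ε * x) (𝓝 t) (𝓝 a) := by
      rw [ha]; exact (by fun_prop : Continuous fun x => p + ε * x).tendsto t
    have h2 : Tendsto (fun x => q + δ * x) (𝓝 t) (𝓝 b) := by
      rw [hb]; exact (by fun_prop : Continuous fun x => q + δ * x).tendsto t
    exact (h1.eventually (lt_mem_nhds (half_lt_self hp))).and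
      (h2.eventually (lt_mem_nhds (half_lt_self hq)))
  refine (hasDerivAt_integral_of_dominated_loc_of_deriv_le
    (bound := fun _ => |ε| * (1 / (a / 2) * π) + |δ| * (1 / (b / 2) * π))
    (F' := fun x r => -(ε * (|r| / (r ^ 2 + (p + ε * x) ^ 2) * arccotAbs (q + δ * x) r) +
      δ * (|r| / (r ^ 2 + (q + δ * x) ^ 2) * arccotAbs (p + ε * x) r))) hU
    (Eventually.of_forall fun b => (by fun_prop : Measurable _).aestronglyMeasurable)
    (integrable_stdCauchy_of_bounded (π * π) (by fun_prop) (abs_arccotAbs_mul_le _ _))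
    (by fun_prop : Measurable _).aestronglyMeasurable
    (Eventually.of_forall fun r x hx => ?_) (integrable_const _) ?_).2
  · rw [norm_neg]
    have h1 : 0 < a / 2 := half_pos hp
    have h2 : 0 < b / 2 := half_pos hq
    refine (norm_add_le _ _).trans (add_le_add ?_ ?_)
    · rw [norm_mul, norm_eq_abs, norm_eq_abs]
      gcongr
      refine (abs_ratio_mul_le (h1.trans hx.1) _ r).trans ?_
      have := hx.1.le
      gcongr
    · rw [norm_mul, norm_eq_abs, norm_eq_abs]
      gcongr
      refine (abs_ratio_mul_le (h2.trans hx.2) _ r).trans ?_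
      have := hx.2.le
      gcongr
  · filter_upwards [ae_stdCauchy_ne 0] with r hr x _
    have h1 : HasDerivAt (fun x => p + ε * x) ε x := by
      simpa using ((hasDerivAt_id x).const_mul ε).const_add p
    have h2 : HasDerivAt (fun x => q + δ * x) δ x := by
      simpa using ((hasDerivAt_id x).const_mul δ).const_add q
    exact (((hasDerivAt_arccotAbs hr _).comp x h1).mul
      ((hasDerivAt_arccotAbs hr _).comp x h2)).congr_deriv (by simp only [Function.comp]; ring)

theorem hasDerivAt_arccotProd_diag {t : ℝ} (ht : 0 < t) :
    HasDerivAt (fun t => arccotProd t t) (-(2 * ratioClosed t t)) t := by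
  have := hasDerivAt_arccotProd_line (p := 0) (q := 0) (ε := 1) (δ := 1) (t := t)
    (by simpa using ht) (by simpa using ht)
  simp only [zero_add, one_mul] at this
  exact this.congr_deriv (by ring)

/-- The denominator (1+a)(1+b) is symmetric, so only the arguments (a+b)/(1+b) ≤ (a+b)/(1+a) of the
decreasing `logSlope` matter. -/
theorem ratioClosed_swap_le {a b : ℝ} (ha : 0 < a) (hab : a ≤ b) :
    ratioClosed b a ≤ ratioClosed a b := by
  have hb := ha.trans_le hab
  unfold ratioClosed
  rw [mul_comm (1 + b), add_comm b a]
  gcongr ?_ / _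
  refine logSlope_anti (by positivity) ?_
  gcongr

/-- Along `a + b = s` the product mean decreases towards the diagonal. -/
theorem antitoneOn_arccotProd_antidiag {s : ℝ} :
    AntitoneOn (fun x => arccotProd x (s - x)) (Icc 0 (s / 2)) := by
  refine antitoneOn_of_hasDerivWithinAt_nonpos
    (f' := fun x => -(ratioClosed x (s - x) - ratioClosed (s - x) x)) (convex_Icc _ _)
    (continuous_arccotProd.comp
      (by fun_prop : Continuous fun x : ℝ => ((x, s - x) : ℝ × ℝ))).continuousOn
    (fun x hx => ?_) (fun x hx => ?_)
  · rw [interior_Icc] at hx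
    have h := hasDerivAt_arccotProd_line (p := 0) (q := s) (ε := 1) (δ := -1) (t := x)
      (by simpa using hx.1) (by linarith [hx.1, hx.2])
    simp only [zero_add, one_mul, neg_mul, ← sub_eq_add_neg] at h
    exact h.hasDerivWithinAt
  · rw [interior_Icc] at hx
    have := ratioClosed_swap_le hx.1 (show x ≤ s - x by linarith [hx.2])
    linarith

theorem errZ_comm (a b : ℝ) : errZ a b = errZ b a := by
  simp only [errZ, mul_comm (arctanDiv _ a), add_comm a]

theorem errZ_bounds {a b : ℝ} (ha : 0 ≤ a) (hb : 0 ≤ b) :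
    0 ≤ errZ a b ∧ errZ a b ≤ errZ ((a + b) / 2) ((a + b) / 2) := by
  wlog hab : a ≤ b generalizing a b
  · rw [errZ_comm a b, add_comm a b]
    exact this hb ha (le_of_not_ge hab)
  have hs : 0 ≤ (a + b) / 2 := by positivity
  -- The order 0 ≤ a ≤ (a+b)/2 on the antidiagonal: the left comparison gives nonnegativity, the
  -- right one the bound by the diagonal.
  have h1 := antitoneOn_arccotProd_antidiag (s := a + b) (a := 0) (b := a)
    ⟨le_rfl, hs⟩ ⟨ha, by linarith⟩ ha
  have h2 := antitoneOn_arccotProd_antidiag (s := a + b) (a := a) (b := (a + b) / 2)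
    ⟨ha, by linarith⟩ ⟨hs, le_rfl⟩ (by linarith)
  simp only [sub_zero, add_sub_cancel_left, sub_half] at h1 h2
  rw [arccotProd_comm 0] at h1
  rw [errZ_eq ha hb, errZ_eq hs hs, add_halves]
  have hpi : 0 < 2 / π ^ 2 := by positivity
  constructor <;> nlinarith

/-! ### Sign analysis of the critical equation -/

/-- The left-hand side of the equation for the maximizer. -/
noncomputable def critFun (t : ℝ) : ℝ :=
  1 / (t ^ 2 - 1) * log (2 * t / (1 + t)) - log (2 * t) / ((2 * t) ^ 2 - 1)

/-- A simplified form of `critFun`, up to a rational factor. -/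
noncomputable def critNum (t : ℝ) : ℝ := 3 * log (2 * t) - (4 - 1 / t ^ 2) * log (1 + t)

/-- `t ^ 3` times the derivative of `critNum`. -/
noncomputable def critDeriv (t : ℝ) : ℝ :=
  3 * t ^ 2 - 2 * log (1 + t) - (4 * t ^ 3 - t) / (1 + t)

theorem critFun_eq {t : ℝ} (ht : 0 < t) (h1 : t ≠ 1) (h2 : t ≠ 1 / 2) :
    critFun t = t ^ 2 / ((t ^ 2 - 1) * ((2 * t) ^ 2 - 1)) * critNum t := by
  have e1 : t ^ 2 - 1 ≠ 0 := fun h => h1 (by nlinarith)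
  have e2 : (2 * t) ^ 2 - 1 ≠ 0 := fun h => h2 (by nlinarith)
  rw [critFun, critNum, log_div (by positivity) (by positivity)]
  generalize log (2 * t) = x
  generalize log (1 + t) = y
  generalize hz : (2 * t) ^ 2 - 1 = z at e2 ⊢
  field_simp
  rw [← hz]
  ring

theorem hasDerivAt_critNum {t : ℝ} (ht : 0 < t) :
    HasDerivAt critNum (critDeriv t / t ^ 3) t := by
  have h1 : 1 + t ≠ 0 := by positivity
  have ha : HasDerivAt (fun t : ℝ => 3 * log (2 * t)) (3 * (2 / (2 * t))) t := by
    simpa using ((((hasDerivAt_id t).const_mul 2).log (by simpa using ht.ne')).const_mul 3)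
  have hb : HasDerivAt (fun t : ℝ => log (1 + t)) (1 / (1 + t)) t := by
    simpa using (((hasDerivAt_id t).const_add 1).log (by simpa using h1))
  have hc : HasDerivAt (fun t : ℝ => 4 - 1 / t ^ 2) (2 / t ^ 3) t := by
    refine (((hasDerivAt_const t (1 : ℝ)).div (hasDerivAt_pow 2 t) (by positivity)).const_sub
      4).congr_deriv ?_
    field_simp
    ring
  refine (ha.sub (hc.mul hb)).congr_deriv ?_
  rw [critDeriv]
  field_simp
  ring

theorem hasDerivAt_critDeriv {t : ℝ} (ht : 0 < 1 + t) :
    HasDerivAt critDeriv ((-2 * t ^ 3 + 4 * t - 1) / (1 + t) ^ 2) t := by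
  have ha : HasDerivAt (fun t : ℝ => 3 * t ^ 2) (3 * (2 * t)) t := by
    simpa using (hasDerivAt_pow 2 t).const_mul 3
  have hb : HasDerivAt (fun t : ℝ => 2 * log (1 + t)) (2 * (1 / (1 + t))) t := by
    simpa using (((hasDerivAt_id t).const_add 1).log (by simpa using ht.ne')).const_mul 2
  have hc : HasDerivAt (fun t : ℝ => 4 * t ^ 3 - t) (4 * (3 * t ^ 2) - 1) t := by
    exact (((hasDerivAt_pow 3 t).const_mul 4).sub (hasDerivAt_id t)).congr_deriv (by norm_num)
  refine ((ha.sub hb).sub (hc.div ((hasDerivAt_id t).const_add 1) ht.ne')).congr_deriv ?_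
  simp only [id]
  field_simp
  ring

theorem critNum_half : critNum (1 / 2) = 0 := by norm_num [critNum]

theorem critNum_one : critNum 1 = 0 := by norm_num [critNum]

theorem continuousOn_critNum : ContinuousOn critNum (Ioi 0) := fun _ hx =>
  (hasDerivAt_critNum hx).continuousAt.continuousWithinAt

theorem continuousOn_critDeriv : ContinuousOn critDeriv (Ioi (-1)) := fun x hx =>
  (hasDerivAt_critDeriv (by linarith [mem_Ioi.1 hx])).continuousAt.continuousWithinAt

theorem strictMonoOn_critNum {a b : ℝ} (ha : 0 < a) (h : ∀ x ∈ Ioo a b, 0 < critDeriv x) :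
    StrictMonoOn critNum (Icc a b) := by
  refine strictMonoOn_of_hasDerivWithinAt_pos (convex_Icc a b)
    (continuousOn_critNum.mono fun x hx => ha.trans_le hx.1)
    (f' := fun x => critDeriv x / x ^ 3) (fun x hx => ?_) (fun x hx => ?_)
  all_goals
    rw [interior_Icc] at hx
    have h0 : 0 < x := ha.trans hx.1
  · exact (hasDerivAt_critNum h0).hasDerivWithinAt
  · exact div_pos (h x hx) (by positivity)

theorem strictAntiOn_critNum {s : Set ℝ} (hs : Convex ℝ s) (h0 : s ⊆ Ioi 0)
    (h : ∀ x ∈ interior s, critDeriv x < 0) : StrictAntiOn critNum s := by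
  refine strictAntiOn_of_hasDerivWithinAt_neg hs (continuousOn_critNum.mono h0)
    (f' := fun x => critDeriv x / x ^ 3) (fun x hx => ?_) (fun x hx => ?_)
  all_goals have hx0 : 0 < x := h0 (interior_subset hx)
  · exact (hasDerivAt_critNum hx0).hasDerivWithinAt
  · exact div_neg_of_neg_of_pos (h x hx) (by positivity)

theorem strictMonoOn_critDeriv : StrictMonoOn critDeriv (Icc (1 / 2) 1) := by
  refine strictMonoOn_of_hasDerivWithinAt_pos (convex_Icc _ _)
    (continuousOn_critDeriv.mono fun x hx => by simp; linarith [hx.1])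
    (f' := fun t => (-2 * t ^ 3 + 4 * t - 1) / (1 + t) ^ 2) (fun x hx => ?_) (fun x hx => ?_)
  all_goals rw [interior_Icc] at hx
  · exact (hasDerivAt_critDeriv (by linarith [hx.1])).hasDerivWithinAt
  · refine div_pos ?_ (pow_pos (by linarith [hx.1]) 2)
    nlinarith [mul_pos (sub_pos.2 hx.1) (sub_pos.2 hx.2), hx.1, hx.2,
      mul_pos (mul_pos (sub_pos.2 hx.1) (sub_pos.2 hx.2)) (by linarith [hx.1] : 0 < x)]

theorem strictAntiOn_critDeriv : StrictAntiOn critDeriv (Ici (1.3)) := by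
  refine strictAntiOn_of_hasDerivWithinAt_neg (convex_Ici _)
    (continuousOn_critDeriv.mono fun x hx => by
      simp only [mem_Ioi]; norm_num at hx; linarith)
    (f' := fun t => (-2 * t ^ 3 + 4 * t - 1) / (1 + t) ^ 2) (fun x hx => ?_) (fun x hx => ?_)
  all_goals
    rw [interior_Ici] at hx
    have hx : 1.3 < x := hx
  · exact (hasDerivAt_critDeriv (by linarith)).hasDerivWithinAt
  · refine div_neg_of_neg_of_pos ?_ (pow_pos (by linarith) 2)
    nlinarith [mul_pos (sub_pos.2 hx) (sub_pos.2 hx), mul_pos (mul_pos (sub_pos.2 hx) (sub_pos.2 hx)) (sub_pos.2 hx)]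

theorem critDeriv_neg_of_le_half {t : ℝ} (h0 : 0 < t) (h1 : t ≤ 1 / 2) : critDeriv t < 0 := by
  have hlog : 2 * t / (t + 2) < log (1 + t) := lt_log_one_add_of_pos h0
  -- Replacing the logarithm by its rational lower bound leaves a cubic that is negative on (0,
  -- 1/2].
  have h : 3 * t ^ 2 - 2 * (2 * t / (t + 2)) - (4 * t ^ 3 - t) / (1 + t) =
      t * (-t ^ 3 + t ^ 2 + 3 * t - 2) / ((t + 2) * (1 + t)) := by
    field_simp
    ring
  have h2 : t * (-t ^ 3 + t ^ 2 + 3 * t - 2) / ((t + 2) * (1 + t)) < 0 := by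
    refine div_neg_of_neg_of_pos (mul_neg_of_pos_of_neg h0 ?_) (by positivity)
    nlinarith [pow_pos h0 3]
  rw [critDeriv]
  linarith

theorem critNum_pos_of_lt_half {t : ℝ} (h0 : 0 < t) (h1 : t < 1 / 2) : 0 < critNum t := by
  rw [← critNum_half]
  refine strictAntiOn_critNum (convex_Ioc 0 (1 / 2)) (fun x hx => hx.1) (fun x hx => ?_)
    ⟨h0, h1.le⟩ ⟨by norm_num, le_rfl⟩ h1
  rw [interior_Ioc] at hx
  exact critDeriv_neg_of_le_half hx.1 hx.2.le

/-- Since `critDeriv` increases on [1/2, 1], `critNum` can only fall and then rise there, and it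
vanishes at both ends. The sign of `critDeriv t` decides which end to compare with. -/
theorem critNum_neg_of_half_lt {t : ℝ} (h0 : 1 / 2 < t) (h1 : t < 1) : critNum t < 0 := by
  rcases le_or_gt (critDeriv t) 0 with h | h
  · rw [← critNum_half]
    refine strictAntiOn_critNum (convex_Icc (1 / 2) t)
      (fun x hx => by simp only [mem_Ioi]; linarith [hx.1]) (fun x hx => ?_)
      ⟨le_rfl, h0.le⟩ ⟨h0.le, le_rfl⟩ h0
    rw [interior_Icc] at hx
    exact (strictMonoOn_critDeriv ⟨hx.1.le, (hx.2.trans h1).le⟩ ⟨h0.le, h1.le⟩ hx.2).trans_le h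
  · rw [← critNum_one]
    refine strictMonoOn_critNum (by linarith) (fun x hx => ?_) ⟨le_rfl, h1.le⟩ ⟨h1.le, le_rfl⟩ h1
    exact h.trans (strictMonoOn_critDeriv ⟨h0.le, h1.le⟩ ⟨(h0.trans hx.1).le, hx.2.le⟩ hx.1)

theorem critDeriv_pos_near_one {t : ℝ} (h0 : 1 ≤ t) (h1 : t ≤ 1.3) : 0 < critDeriv t := by
  -- The tangent line of the concave function log(1+t) at t = 1.
  have h2 : log (1 + t) ≤ log 2 + (t - 1) / 2 := by
    have h := log_le_sub_one_of_pos (show 0 < (1 + t) / 2 by linarith)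
    rw [log_div (by linarith) two_ne_zero] at h
    linarith
  have h3 : (4 * t ^ 3 - t) / (1 + t) < 3 * t ^ 2 - 2 * 0.6931471808 - (t - 1) := by
    rw [div_lt_iff₀ (by linarith)]
    norm_num at h1 ⊢
    nlinarith [mul_nonneg (sub_nonneg.2 h0) (sub_nonneg.2 h1),
      mul_nonneg (mul_nonneg (sub_nonneg.2 h0) (sub_nonneg.2 h1)) (by linarith : 0 ≤ t)]
  have h4 := log_two_lt_d9
  rw [critDeriv]
  linarith

theorem critDeriv_two_neg : critDeriv 2 < 0 := by
  have := log_three_gt_d9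
  rw [critDeriv]
  norm_num
  linarith

theorem critNum_two_pos : 0 < critNum 2 := by
  have h1 := log_three_lt_d9
  have h2 := log_two_gt_d9
  have h3 := log_four_eq
  rw [critNum]
  norm_num
  linarith

theorem critNum_pos_near_one {t : ℝ} (h0 : 1 < t) (h1 : t ≤ 1.3) : 0 < critNum t := by
  rw [← critNum_one]
  exact strictMonoOn_critNum one_pos
    (fun x hx => critDeriv_pos_near_one hx.1.le (hx.2.le.trans h1)) ⟨le_rfl, h0.le⟩
    ⟨h0.le, le_rfl⟩ h0

/-- Beyond 1.3 `critDeriv` decreases, so `critNum` rises and then falls; positivity at 1.3 and at 2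
controls everything between. -/
theorem critNum_pos_of_le_two {t : ℝ} (h0 : 1 < t) (h1 : t ≤ 2) : 0 < critNum t := by
  rcases le_or_gt t 1.3 with h2 | h2
  · exact critNum_pos_near_one h0 h2
  rcases le_or_gt 0 (critDeriv t) with h | h
  · refine (critNum_pos_near_one (t := 1.3) (by norm_num) le_rfl).trans ?_
    refine strictMonoOn_critNum (by norm_num) (fun x hx => ?_) ⟨le_rfl, h2.le⟩
      ⟨h2.le, le_rfl⟩ h2
    exact h.trans_lt (strictAntiOn_critDeriv hx.1.le h2.le hx.2)
  · rcases h1.eq_or_lt with rfl | h1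
    · exact critNum_two_pos
    refine critNum_two_pos.trans ?_
    refine strictAntiOn_critNum (convex_Icc t 2)
      (fun x hx => by simp only [mem_Ioi]; linarith [hx.1]) (fun x hx => ?_)
      ⟨le_rfl, h1.le⟩ ⟨h1.le, le_rfl⟩ h1
    rw [interior_Icc] at hx
    exact (strictAntiOn_critDeriv h2.le (h2.trans hx.1).le hx.1).trans h

theorem strictAntiOn_critNum_two : StrictAntiOn critNum (Ici 2) := by
  refine strictAntiOn_critNum (convex_Ici 2)
    (fun x hx => by simp only [mem_Ioi]; linarith [mem_Ici.1 hx]) (fun x hx => ?_)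
  rw [interior_Ici] at hx
  have hx : 2 < x := hx
  exact (strictAntiOn_critDeriv (by norm_num : (2 : ℝ) ∈ Ici 1.3)
    (by simp only [mem_Ici]; norm_num; linarith) hx).trans critDeriv_two_neg

/-! ### Numerical location of the root -/

/-- The series log((1+x)/(1−x)) = 2 artanh x with its remainder; it is applied at x = (p−1)/(p+1)
for p near 1, where few terms suffice. -/
theorem log_div_bounds (p x : ℝ) (n : ℕ) (h0 : 0 ≤ x) (h1 : x < 1) (hp : p = (1 + x) / (1 - x)) :
    2 * ∑ i ∈ Finset.range n, x ^ (2 * i + 1) / (2 * i + 1) ≤ log p ∧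
    log p ≤ 2 * ((∑ i ∈ Finset.range n, x ^ (2 * i + 1) / (2 * i + 1)) +
      x ^ (2 * n + 1) / (1 - x ^ 2)) := by
  have h2 := sum_range_le_log_div h0 h1 n
  have h3 := log_div_le_sum_range_add h0 h1 n
  rw [hp]
  constructor <;> linarith

theorem critNum_lo_pos : 0 < critNum 2.779345 := by
  -- Splitting off 5 here and 4 below leaves arguments close to 1, where the artanh series converges
  -- fast.
  have h1 : log (2 * 2.779345) = log 5 + log 1.111738 := by
    rw [← log_mul] <;> norm_num
  have h2 : log (1 + 2.779345) = 2 * log 2 - log (4 / 3.779345) := by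
    rw [← log_four_eq, ← log_div] <;> norm_num
  have h3 := (log_div_bounds 1.111738 (0.111738 / 2.111738) 4 (by norm_num) (by norm_num)
    (by norm_num)).1
  have h4 := (log_div_bounds (4 / 3.779345) (0.220655 / 7.779345) 4 (by norm_num) (by norm_num)
    (by norm_num)).1
  rw [critNum, h1, h2]
  have h5 := log_five_gt_d9
  have h6 := log_two_lt_d9
  norm_num [Finset.sum_range_succ] at h3 h4 ⊢
  linarith

theorem critNum_hi_neg : critNum 2.779355 < 0 := by
  have h1 : log (2 * 2.779355) = log 5 + log 1.111742 := by
    rw [← log_mul] <;> norm_num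
  have h2 : log (1 + 2.779355) = 2 * log 2 - log (4 / 3.779355) := by
    rw [← log_four_eq, ← log_div] <;> norm_num
  have h3 := (log_div_bounds 1.111742 (0.111742 / 2.111742) 4 (by norm_num) (by norm_num)
    (by norm_num)).2
  have h4 := (log_div_bounds (4 / 3.779355) (0.220645 / 7.779355) 4 (by norm_num) (by norm_num)
    (by norm_num)).2
  rw [critNum, h1, h2]
  have h5 := log_five_lt_d9
  have h6 := log_two_gt_d9
  norm_num [Finset.sum_range_succ] at h3 h4 ⊢
  linarith

theorem exists_critNum_zero :
    ∃ t : ℝ, 2.779345 ≤ t ∧ t ≤ 2.779355 ∧ critNum t = 0 := by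
  have h : (2.779345 : ℝ) ≤ 2.779355 := by norm_num
  have hc : ContinuousOn critNum (Icc 2.779345 2.779355) := continuousOn_critNum.mono
    fun x hx => by simp only [mem_Ioi]; have := hx.1; norm_num at this; linarith
  obtain ⟨t, ht, h0⟩ := intermediate_value_Icc' h hc ⟨critNum_hi_neg.le, critNum_lo_pos.le⟩
  exact ⟨t, ht.1, ht.2, h0⟩

/-- At t = 1 the convention 1/0 = 0 removes the first term, leaving −log 2/3. So t = 1 is no
spurious root, although the sign differs from that of nearby values. -/
theorem critFun_one_neg : critFun 1 < 0 := by
  have : 0 < log 2 := log_pos one_lt_two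
  rw [critFun]
  norm_num
  positivity

/-- Here the second term is 0/0 = 0, and the first is a product of two negative numbers. -/
theorem critFun_half_pos : 0 < critFun (1 / 2) := by
  have h : log (2 / 3) < 0 := log_neg (by norm_num) (by norm_num)
  rw [critFun]
  norm_num
  linarith

/-! ### Monotonicity along the diagonal and the maximum -/

section Root

variable {t₀ : ℝ}

theorem critNum_pos_of_lt_root (h2 : 2 ≤ t₀) (h0 : critNum t₀ = 0) {t : ℝ} (h1 : 1 < t)
    (ht : t < t₀) : 0 < critNum t := by
  rcases le_or_gt t 2 with h | h
  · exact critNum_pos_of_le_two h1 h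
  · rw [← h0]; exact strictAntiOn_critNum_two h.le h2 ht

theorem critNum_neg_of_root_lt (h2 : 2 ≤ t₀) (h0 : critNum t₀ = 0) {t : ℝ} (ht : t₀ < t) :
    critNum t < 0 := by
  rw [← h0]; exact strictAntiOn_critNum_two h2 (h2.trans ht.le) ht

theorem critFun_pos_of_lt_root (h2 : 2 ≤ t₀) (h0 : critNum t₀ = 0) {t : ℝ} (h : 0 < t)
    (ht1 : t ≠ 1) (ht : t < t₀) : 0 < critFun t := by
  rcases eq_or_ne t (1 / 2) with rfl | hh
  · exact critFun_half_pos
  rw [critFun_eq h ht1 hh]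
  rcases lt_or_gt_of_ne hh with h3 | h3
  · refine mul_pos (div_pos (by positivity) (mul_pos_of_neg_of_neg ?_ ?_))
      (critNum_pos_of_lt_half h h3) <;> nlinarith
  rcases lt_or_gt_of_ne ht1 with h4 | h4
  · refine mul_pos_of_neg_of_neg (div_neg_of_pos_of_neg (by positivity)
      (mul_neg_of_neg_of_pos ?_ ?_)) (critNum_neg_of_half_lt h3 h4) <;> nlinarith
  · refine mul_pos (div_pos (by positivity) (mul_pos ?_ ?_))
      (critNum_pos_of_lt_root h2 h0 h4 ht) <;> nlinarith

theorem critFun_neg_of_root_lt (h2 : 2 ≤ t₀) (h0 : critNum t₀ = 0) {t : ℝ} (ht : t₀ < t) :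
    critFun t < 0 := by
  rw [critFun_eq (by linarith) (by linarith) (by linarith)]
  refine mul_neg_of_pos_of_neg (div_pos (by nlinarith) (mul_pos ?_ ?_))
    (critNum_neg_of_root_lt h2 h0 ht) <;> nlinarith

theorem critFun_root (h2 : 2 ≤ t₀) (h0 : critNum t₀ = 0) : critFun t₀ = 0 := by
  rw [critFun_eq (by linarith) (by linarith) (by linarith), h0, mul_zero]

theorem eq_root_of_critFun_eq_zero (h2 : 2 ≤ t₀) (h0 : critNum t₀ = 0) {t : ℝ} (h : 0 < t)
    (ht : critFun t = 0) : t = t₀ := by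
  rcases eq_or_ne t 1 with rfl | h1
  · exact absurd ht critFun_one_neg.ne
  rcases lt_trichotomy t t₀ with h3 | h3 | h3
  · exact absurd ht (critFun_pos_of_lt_root h2 h0 h h1 h3).ne'
  · exact h3
  · exact absurd ht (critFun_neg_of_root_lt h2 h0 h3).ne

theorem hasDerivAt_errZ_diag {t : ℝ} (h : 0 < t) (h1 : t ≠ 1) (hh : t ≠ 1 / 2) :
    HasDerivAt (fun t => errZ t t) (4 / π ^ 2 * critFun t) t := by
  have h2 : HasDerivAt (fun t => arccotProd (2 * t) 0) (-ratioClosed (2 * t) 0 * 2) t := by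
    have hf := hasDerivAt_arccotProd_left (a := 2 * t) (b := 0) (by positivity) le_rfl
    have hg : HasDerivAt (fun t : ℝ => 2 * t) 2 t := by
      simpa using (hasDerivAt_id t).const_mul 2
    exact HasDerivAt.comp (h₂ := fun a => arccotProd a 0) (h := fun t => 2 * t) t hf hg
  have h3 := ((hasDerivAt_arccotProd_diag h).sub h2).const_mul (-(2 / π ^ 2))
  have h4 : (fun t => errZ t t) =ᶠ[𝓝 t]
      fun t => -(2 / π ^ 2) * (arccotProd t t - arccotProd (2 * t) 0) := by
    filter_upwards [lt_mem_nhds h] with x hx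
    rw [errZ_eq hx.le hx.le, two_mul]
  refine (h3.congr_of_eventuallyEq h4).congr_deriv ?_
  rw [ratioClosed_of_ne h1 h h.le, ratioClosed_of_ne (fun h' => hh (by linarith))
    (by positivity) le_rfl, critFun, show t + t = 2 * t by ring, add_zero, add_zero, div_one]
  ring

theorem continuousOn_errZ_diag : ContinuousOn (fun t => errZ t t) (Ici 0) := by
  have h : Continuous fun t => -(2 / π ^ 2) * (arccotProd t t - arccotProd (t + t) 0) := by
    have h1 : Continuous fun t : ℝ => arccotProd t t :=
      Continuous.comp (g := fun p : ℝ × ℝ => arccotProd p.1 p.2) (f := fun t => (t, t))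
        continuous_arccotProd (by fun_prop)
    have h2 : Continuous fun t : ℝ => arccotProd (t + t) 0 :=
      Continuous.comp (g := fun p : ℝ × ℝ => arccotProd p.1 p.2) (f := fun t => (t + t, 0))
        continuous_arccotProd (by fun_prop)
    exact continuous_const.mul (h1.sub h2)
  exact h.continuousOn.congr fun t ht => errZ_eq ht ht

/-- The derivative formula excludes 1 and 1/2, so monotonicity is proved on intervals with neither
point inside; continuity lets these intervals be glued. -/
theorem monotoneOn_errZ_diag (h2 : 2 ≤ t₀) (h0 : critNum t₀ = 0) {a b : ℝ} (ha : 0 ≤ a)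
    (hb : b ≤ t₀) (h1 : 1 ∉ Ioo a b) (hh : 1 / 2 ∉ Ioo a b) :
    MonotoneOn (fun t => errZ t t) (Icc a b) := by
  refine monotoneOn_of_hasDerivWithinAt_nonneg (convex_Icc a b)
    (continuousOn_errZ_diag.mono fun x hx => ha.trans hx.1)
    (f' := fun t => 4 / π ^ 2 * critFun t) (fun x hx => ?_) (fun x hx => ?_)
  all_goals
    rw [interior_Icc] at hx
    have hx0 : 0 < x := ha.trans_lt hx.1
    have hx1 : x ≠ 1 := fun h => h1 (h ▸ hx)
    have hxh : x ≠ 1 / 2 := fun h => hh (h ▸ hx)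
  · exact (hasDerivAt_errZ_diag hx0 hx1 hxh).hasDerivWithinAt
  · exact mul_nonneg (by positivity)
      (critFun_pos_of_lt_root h2 h0 hx0 hx1 (hx.2.trans_le hb)).le

theorem errZ_diag_le (h2 : 2 ≤ t₀) (h0 : critNum t₀ = 0) {t : ℝ} (ht : 0 ≤ t) :
    errZ t t ≤ errZ t₀ t₀ := by
  have m1 := monotoneOn_errZ_diag h2 h0 (a := 0) (b := 1 / 2) le_rfl (by linarith)
    (by norm_num) (by norm_num)
  have m2 := monotoneOn_errZ_diag h2 h0 (a := 1 / 2) (b := 1) (by norm_num) (by linarith)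
    (by norm_num) (by norm_num)
  have m3 := monotoneOn_errZ_diag h2 h0 (a := 1) (b := t₀) (by norm_num) le_rfl
    (by norm_num) (fun h => by linarith [h.1])
  have e1 : errZ 1 1 ≤ errZ t₀ t₀ :=
    m3 ⟨le_rfl, by linarith⟩ ⟨by linarith, le_rfl⟩ (by linarith)
  have e2 : errZ (1 / 2) (1 / 2) ≤ errZ 1 1 :=
    m2 ⟨le_rfl, by norm_num⟩ ⟨by norm_num, le_rfl⟩ (by norm_num)
  rcases le_total t (1 / 2) with h | h
  · exact (m1 ⟨ht, h⟩ ⟨by norm_num, le_rfl⟩ h).trans (e2.trans e1)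
  rcases le_total t 1 with h' | h'
  · exact (m2 ⟨h, h'⟩ ⟨by norm_num, le_rfl⟩ h').trans e1
  rcases le_total t t₀ with h'' | h''
  · exact m3 ⟨h', h''⟩ ⟨by linarith, le_rfl⟩ h''
  have m4 : AntitoneOn (fun t => errZ t t) (Ici t₀) := by
    refine antitoneOn_of_hasDerivWithinAt_nonpos (convex_Ici t₀)
      (continuousOn_errZ_diag.mono fun x hx => le_trans (by linarith) (mem_Ici.1 hx))
      (f' := fun t => 4 / π ^ 2 * critFun t) (fun x hx => ?_) (fun x hx => ?_)
    all_goals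
      rw [interior_Ici] at hx
      have hx : t₀ < x := hx
    · exact (hasDerivAt_errZ_diag (by linarith) (by linarith) (by linarith)).hasDerivWithinAt
    · exact mul_nonpos_of_nonneg_of_nonpos (by positivity) (critFun_neg_of_root_lt h2 h0 hx).le
  exact m4 self_mem_Ici h'' h''

end Root

theorem errZ_diag_eq_integral {t : ℝ} (ht : 0 < t) :
    errZ t t = ∫ r in Ioi (0 : ℝ),
      (-(2 / π ^ 2) * arctan (r / t) ^ 2 + 1 / π * arctan (r / (2 * t)))
        * (2 / π * (1 / (1 + r ^ 2))) := by
  rw [← integral_stdCauchy_abs fun r =>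
    -(2 / π ^ 2) * arctan (r / t) ^ 2 + 1 / π * arctan (r / (2 * t))]
  have hb : ∀ x : ℝ, |arctan x| ≤ π / 2 := fun x =>
    abs_le.2 ⟨(neg_pi_div_two_lt_arctan x).le, (arctan_lt_pi_div_two x).le⟩
  have i1 : Integrable (fun r : ℝ => arctan (|r| / t) ^ 2) stdCauchy :=
    integrable_stdCauchy_of_bounded ((π / 2) ^ 2) (by fun_prop) fun x => by
      rw [abs_pow]; exact pow_le_pow_left₀ (abs_nonneg _) (hb _) 2
  have i2 : Integrable (fun r : ℝ => arctan (|r| / (2 * t))) stdCauchy :=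
    integrable_stdCauchy_of_bounded (π / 2) (by fun_prop) fun x => hb _
  rw [integral_add (i1.const_mul _) (i2.const_mul _), integral_const_mul, integral_const_mul]
  simp only [errZ, arctanDiv, ht.ne', false_and, if_false, (add_pos ht ht).ne', sq, two_mul]

/-! ### Numerical value of the maximum -/

/-- At a = b = 1 the Cauchy density is proportional to the derivative of arctan, so arctan³/3 gives
a primitive. -/
theorem arccotProd_one_one : arccotProd 1 1 = π ^ 2 / 12 := by
  have h : arccotProd 1 1 = ∫ r, arctan |r| ^ 2 ∂stdCauchy := by
    refine integral_congr_ae ?_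
    filter_upwards [ae_stdCauchy_ne 0] with r hr
    rw [← arctanDiv_eq_arccotAbs zero_le_one hr, arctanDiv, if_neg (by simp), div_one, sq]
  rw [h, integral_stdCauchy_abs fun r => arctan r ^ 2]
  have hd : ∀ r ∈ Ici (0 : ℝ), HasDerivAt (fun r => 2 / π * (arctan r ^ 3 / 3))
      (arctan r ^ 2 * (2 / π * (1 / (1 + r ^ 2)))) r := by
    intro r _
    refine ((((hasDerivAt_arctan r).pow 3).div_const 3).const_mul (2 / π)).congr_deriv ?_
    norm_num
    ring
  have ht : Tendsto (fun r => 2 / π * (arctan r ^ 3 / 3)) atTop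
      (𝓝 (2 / π * ((π / 2) ^ 3 / 3))) :=
    (((tendsto_nhds_of_tendsto_nhdsWithin tendsto_arctan_atTop).pow 3).div_const 3).const_mul _
  rw [integral_Ioi_of_hasDerivAt_of_nonneg' hd (fun r _ => by positivity) ht, arctan_zero]
  field_simp
  ring

/-- The Taylor polynomial of degree `n` of `log (1 + w)`. -/
noncomputable def logTaylor (n : ℕ) (w : ℝ) : ℝ :=
  ∑ k ∈ Finset.range n, (-1) ^ k * w ^ (k + 1) / (k + 1)

/-- The derivative of the Taylor polynomial is a finite geometric sum, so the remainder's derivative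
has a sign fixed by the parity of n when w ≥ 0. -/
theorem hasDerivAt_log_sub_logTaylor (n : ℕ) {w : ℝ} (hw : 0 < 1 + w) :
    HasDerivAt (fun w => log (1 + w) - logTaylor n w) ((-w) ^ n / (1 + w)) w := by
  have h1 : HasDerivAt (fun t : ℝ => log (1 + t)) (1 / (1 + w)) w := by
    simpa using (((hasDerivAt_id w).const_add 1).log (by simpa using hw.ne'))
  have h2 : HasDerivAt (logTaylor n) (∑ k ∈ Finset.range n, (-w) ^ k) w := by
    unfold logTaylor
    refine HasDerivAt.fun_sum fun k _ => ?_
    refine (((hasDerivAt_pow (k + 1) w).const_mul ((-1) ^ k)).div_const _).congr_deriv ?_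
    have : (k : ℝ) + 1 ≠ 0 := by positivity
    rw [neg_pow w k]
    push_cast
    field_simp
  refine (h1.sub h2).congr_deriv ?_
  rw [geom_sum_eq (by linarith)]
  have : -w - 1 ≠ 0 := by linarith
  field_simp
  ring

theorem logTaylor_zero (n : ℕ) : logTaylor n 0 = 0 := by simp [logTaylor]

theorem logTaylor_le_log {n : ℕ} (hn : Even n) {w : ℝ} (hw : 0 ≤ w) :
    logTaylor n w ≤ log (1 + w) := by
  have hm : MonotoneOn (fun w => log (1 + w) - logTaylor n w) (Ici 0) := by
    refine monotoneOn_of_hasDerivWithinAt_nonneg (convex_Ici 0)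
      (fun x hx => (hasDerivAt_log_sub_logTaylor n
        (by linarith [mem_Ici.1 hx])).continuousAt.continuousWithinAt)
      (f' := fun w => (-w) ^ n / (1 + w)) (fun x hx => ?_) (fun x hx => ?_)
    all_goals
      rw [interior_Ici] at hx
      have hx : 0 < x := hx
    · exact (hasDerivAt_log_sub_logTaylor n (by linarith)).hasDerivWithinAt
    · exact div_nonneg (hn.pow_nonneg _) (by linarith)
  have := hm self_mem_Ici hw hw
  simp only [add_zero, log_one, logTaylor_zero] at this
  linarith

theorem log_le_logTaylor {n : ℕ} (hn : Odd n) {w : ℝ} (hw : 0 ≤ w) :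
    log (1 + w) ≤ logTaylor n w := by
  have hm : AntitoneOn (fun w => log (1 + w) - logTaylor n w) (Ici 0) := by
    refine antitoneOn_of_hasDerivWithinAt_nonpos (convex_Ici 0)
      (fun x hx => (hasDerivAt_log_sub_logTaylor n
        (by linarith [mem_Ici.1 hx])).continuousAt.continuousWithinAt)
      (f' := fun w => (-w) ^ n / (1 + w)) (fun x hx => ?_) (fun x hx => ?_)
    all_goals
      rw [interior_Ici] at hx
      have hx : 0 < x := hx
    · exact (hasDerivAt_log_sub_logTaylor n (by linarith)).hasDerivWithinAt
    · exact div_nonpos_of_nonpos_of_nonneg (hn.pow_nonpos (by linarith)) (by linarith)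
  have := hm self_mem_Ici hw hw
  simp only [add_zero, log_one, logTaylor_zero] at this
  linarith

/-- The Taylor polynomial of degree `n` of `∫₀ʷ log (1 + x) / x dx`. -/
noncomputable def dilogTaylor (n : ℕ) (w : ℝ) : ℝ :=
  ∑ k ∈ Finset.range n, (-1) ^ k * w ^ (k + 1) / (k + 1) ^ 2

theorem hasDerivAt_dilogTaylor (n : ℕ) {w : ℝ} (hw : w ≠ 0) :
    HasDerivAt (dilogTaylor n) (logTaylor n w / w) w := by
  unfold dilogTaylor logTaylor
  rw [Finset.sum_div]
  refine HasDerivAt.fun_sum fun k _ => ?_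
  refine (((hasDerivAt_pow (k + 1) w).const_mul ((-1) ^ k)).div_const _).congr_deriv ?_
  have : (k : ℝ) + 1 ≠ 0 := by positivity
  push_cast
  field_simp
  simp [pow_succ, mul_comm]

theorem continuous_dilogTaylor (n : ℕ) : Continuous (dilogTaylor n) := by
  unfold dilogTaylor; fun_prop

/-- With w = (t−1)/(t+1) one has 1+w = 2t/(1+t) and dw/w = 2 dt/(t²−1), so −dP(t,t) becomes log(1+w)
dw/w, the dilogarithm integrand. -/
theorem hasDerivAt_diag_remainder (n : ℕ) {t : ℝ} (ht : 1 < t) :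
    HasDerivAt (fun t => arccotProd t t + dilogTaylor n ((t - 1) / (t + 1)))
      (2 / (t ^ 2 - 1) * (logTaylor n ((t - 1) / (t + 1)) - log (1 + (t - 1) / (t + 1)))) t := by
  have h0 : t + 1 ≠ 0 := by linarith
  have h1 : t - 1 ≠ 0 := by linarith
  have hw : HasDerivAt (fun t : ℝ => (t - 1) / (t + 1)) (2 / (t + 1) ^ 2) t := by
    refine (((hasDerivAt_id t).sub_const 1).div ((hasDerivAt_id t).add_const 1)
      h0).congr_deriv ?_
    simp only [id]
    field_simp
    ring
  have h2 := (hasDerivAt_dilogTaylor n (div_ne_zero h1 h0)).comp t hw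
  refine ((hasDerivAt_arccotProd_diag (by linarith)).add h2).congr_deriv ?_
  rw [ratioClosed_of_ne ht.ne' (by linarith) (by linarith),
    show 1 + (t - 1) / (t + 1) = (t + t) / (1 + t) by field_simp; ring,
    show t ^ 2 - 1 = (t - 1) * (t + 1) by ring]
  field_simp
  ring

theorem continuousOn_diag_remainder (n : ℕ) :
    ContinuousOn (fun t => arccotProd t t + dilogTaylor n ((t - 1) / (t + 1))) (Ici 1) := by
  have h1 : Continuous fun t : ℝ => arccotProd t t :=
    Continuous.comp (g := fun p : ℝ × ℝ => arccotProd p.1 p.2) (f := fun t => (t, t))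
      continuous_arccotProd (by fun_prop)
  refine h1.continuousOn.add ((continuous_dilogTaylor n).comp_continuousOn ?_)
  refine ContinuousOn.div (by fun_prop) (by fun_prop) fun x hx => ?_
  linarith [mem_Ici.1 hx]

theorem arccotProd_diag_le {n : ℕ} (hn : Even n) {t : ℝ} (ht : 1 ≤ t) :
    arccotProd t t ≤ π ^ 2 / 12 - dilogTaylor n ((t - 1) / (t + 1)) := by
  have hm : AntitoneOn (fun t => arccotProd t t + dilogTaylor n ((t - 1) / (t + 1))) (Ici 1) := by
    refine antitoneOn_of_hasDerivWithinAt_nonpos (convex_Ici 1) (continuousOn_diag_remainder n)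
      (f' := fun t => 2 / (t ^ 2 - 1) *
        (logTaylor n ((t - 1) / (t + 1)) - log (1 + (t - 1) / (t + 1))))
      (fun x hx => ?_) (fun x hx => ?_)
    all_goals
      rw [interior_Ici] at hx
      have hx : 1 < x := hx
    · exact (hasDerivAt_diag_remainder n hx).hasDerivWithinAt
    · refine mul_nonpos_of_nonneg_of_nonpos (div_nonneg two_pos.le (by nlinarith)) ?_
      exact sub_nonpos.2 (logTaylor_le_log hn (div_nonneg (by linarith) (by linarith)))
  have := hm self_mem_Ici ht ht
  simp only [sub_self, zero_div, arccotProd_one_one] at this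
  have h0 : dilogTaylor n 0 = 0 := by simp [dilogTaylor]
  linarith

theorem le_arccotProd_diag {n : ℕ} (hn : Odd n) {t : ℝ} (ht : 1 ≤ t) :
    π ^ 2 / 12 - dilogTaylor n ((t - 1) / (t + 1)) ≤ arccotProd t t := by
  have hm : MonotoneOn (fun t => arccotProd t t + dilogTaylor n ((t - 1) / (t + 1))) (Ici 1) := by
    refine monotoneOn_of_hasDerivWithinAt_nonneg (convex_Ici 1) (continuousOn_diag_remainder n)
      (f' := fun t => 2 / (t ^ 2 - 1) *
        (logTaylor n ((t - 1) / (t + 1)) - log (1 + (t - 1) / (t + 1))))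
      (fun x hx => ?_) (fun x hx => ?_)
    all_goals
      rw [interior_Ici] at hx
      have hx : 1 < x := hx
    · exact (hasDerivAt_diag_remainder n hx).hasDerivWithinAt
    · refine mul_nonneg (div_nonneg two_pos.le (by nlinarith)) ?_
      exact sub_nonneg.2 (log_le_logTaylor hn (div_nonneg (by linarith) (by linarith)))
  have := hm self_mem_Ici ht ht
  simp only [sub_self, zero_div, arccotProd_one_one] at this
  have h0 : dilogTaylor n 0 = 0 := by simp [dilogTaylor]
  linarith

/-- `∫ₛ^∞ x ^ (-(m + 1)) log x dx`. -/
noncomputable def logTail (m : ℕ) (s : ℝ) : ℝ := (log s / m + 1 / m ^ 2) / s ^ m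

theorem hasDerivAt_logTail {m : ℕ} (hm : m ≠ 0) {s : ℝ} (hs : 0 < s) :
    HasDerivAt (logTail m) (-(log s / s ^ (m + 1))) s := by
  obtain ⟨m, rfl⟩ := Nat.exists_eq_succ_of_ne_zero hm
  refine ((((hasDerivAt_log hs.ne').div_const _).add_const _).div (hasDerivAt_pow _ s)
    (by positivity)).congr_deriv ?_
  push_cast
  simp only [Nat.succ_eq_add_one]
  field_simp
  ring

theorem tendsto_logTail {m : ℕ} (hm : m ≠ 0) : Tendsto (logTail m) atTop (𝓝 0) := by
  have h1 : Tendsto (fun s : ℝ => log s / s ^ m) atTop (𝓝 0) :=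
    (isLittleO_log_id_atTop.trans_isBigO (by
      refine Asymptotics.IsBigO.of_bound 1 ?_
      filter_upwards [eventually_ge_atTop 1] with x hx
      rw [one_mul, id, norm_of_nonneg (by linarith), norm_of_nonneg (by positivity)]
      exact le_self_pow₀ hx hm)).tendsto_div_nhds_zero
  have h2 : Tendsto (fun s : ℝ => 1 / m ^ 2 / s ^ m) atTop (𝓝 0) :=
    tendsto_const_nhds.div_atTop (tendsto_pow_atTop hm)
  have h3 := (h1.div_const (m : ℝ)).add h2
  simp only [zero_div, add_zero] at h3
  refine h3.congr fun s => ?_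
  rw [logTail]
  ring

theorem nonneg_of_deriv_nonpos_of_tendsto {f f' : ℝ → ℝ} {s : ℝ}
    (hf : ∀ x ∈ Ici s, HasDerivAt f (f' x) x) (hf' : ∀ x ∈ Ici s, f' x ≤ 0)
    (ht : Tendsto f atTop (𝓝 0)) : 0 ≤ f s := by
  have hm : AntitoneOn f (Ici s) :=
    antitoneOn_of_hasDerivWithinAt_nonpos (convex_Ici s)
      (fun x hx => (hf x hx).continuousAt.continuousWithinAt)
      (fun x hx => (hf x (interior_subset hx)).hasDerivWithinAt)
      (fun x hx => hf' x (interior_subset hx))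
  refine le_of_tendsto ht ?_
  filter_upwards [eventually_ge_atTop s] with x hx using hm self_mem_Ici hx hx

theorem hasDerivAt_arccotProd_zero {s : ℝ} (hs : 1 < s) :
    HasDerivAt (fun s => arccotProd s 0) (-(log s / (s ^ 2 - 1))) s := by
  have h := hasDerivAt_arccotProd_left (a := s) (b := 0) (by linarith) le_rfl
  rwa [ratioClosed_of_ne hs.ne' (by linarith) le_rfl, add_zero, add_zero, div_one] at h

/-- Expanding log s/(s²−1) in powers of 1/s² and integrating each term from s to infinity yields the
`logTail` terms; cutting off leaves a positive remainder. -/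
theorem le_arccotProd_zero {s : ℝ} (hs : 4 ≤ s) :
    logTail 1 s + logTail 3 s + logTail 5 s ≤ arccotProd s 0 := by
  rw [← sub_nonneg]
  refine nonneg_of_deriv_nonpos_of_tendsto
    (f := fun s => arccotProd s 0 - (logTail 1 s + logTail 3 s + logTail 5 s))
    (f' := fun s => -(log s * (1 / ((s ^ 2 - 1) * s ^ 6)))) (fun x hx => ?_) (fun x hx => ?_) ?_
  · have hx : s ≤ x := hx
    have h0 : 0 < x := by linarith
    refine ((hasDerivAt_arccotProd_zero (by linarith)).sub
      (((hasDerivAt_logTail one_ne_zero h0).add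
      (hasDerivAt_logTail three_ne_zero h0)).add
      (hasDerivAt_logTail (by norm_num : 5 ≠ 0) h0))).congr_deriv ?_
    have : x ^ 2 - 1 ≠ 0 := by nlinarith
    field_simp
    ring
  · have hx : s ≤ x := hx
    have h1 : 0 ≤ log x := log_nonneg (by linarith)
    have h2 : 0 < x ^ 2 - 1 := by nlinarith
    rw [neg_nonpos]
    positivity
  · simpa using (tendsto_arccotProd_atTop 0).sub (((tendsto_logTail one_ne_zero).add
      (tendsto_logTail three_ne_zero)).add (tendsto_logTail (by norm_num : 5 ≠ 0)))

theorem arccotProd_zero_le {s : ℝ} (hs : 4 ≤ s) :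
    arccotProd s 0 ≤ logTail 1 s + logTail 3 s + logTail 5 s + 1.1 * logTail 7 s := by
  rw [← sub_nonneg]
  refine nonneg_of_deriv_nonpos_of_tendsto
    (f := fun s => logTail 1 s + logTail 3 s + logTail 5 s + 1.1 * logTail 7 s - arccotProd s 0)
    (f' := fun s => -(log s * (1.1 / s ^ 8 - 1 / ((s ^ 2 - 1) * s ^ 6))))
    (fun x hx => ?_) (fun x hx => ?_) ?_
  · have hx : s ≤ x := hx
    have h0 : 0 < x := by linarith
    refine (((((hasDerivAt_logTail one_ne_zero h0).add
      (hasDerivAt_logTail three_ne_zero h0)).add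
      (hasDerivAt_logTail (by norm_num : 5 ≠ 0) h0)).add
      ((hasDerivAt_logTail (by norm_num : 7 ≠ 0) h0).const_mul 1.1)).sub
      (hasDerivAt_arccotProd_zero (by linarith))).congr_deriv ?_
    have : x ^ 2 - 1 ≠ 0 := by nlinarith
    field_simp
    ring
  · have hx : s ≤ x := hx
    have h1 : 0 ≤ log x := log_nonneg (by linarith)
    have h2 : 0 < x ^ 2 - 1 := by nlinarith
    have h3 : 0 < x := by linarith
    rw [neg_nonpos]
    refine mul_nonneg h1 (sub_nonneg.2 ?_)
    rw [div_le_div_iff₀ (by positivity) (by positivity)]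
    -- The geometric remainder exceeds its first term by the factor x²/(x²−1), which is at most 1.1
    -- once x² ≥ 11, hence for x ≥ 4.
    have : 0 ≤ x ^ 6 * (0.1 * x ^ 2 - 1.1) := mul_nonneg (by positivity) (by norm_num; nlinarith)
    linarith
  · simpa using ((((tendsto_logTail one_ne_zero).add
      (tendsto_logTail three_ne_zero)).add (tendsto_logTail (by norm_num : 5 ≠ 0))).add
      ((tendsto_logTail (by norm_num : 7 ≠ 0)).const_mul 1.1)).sub (tendsto_arccotProd_atTop 0)

theorem arccotAbs_anti {a b : ℝ} (h : a ≤ b) (r : ℝ) : arccotAbs b r ≤ arccotAbs a r :=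
  sub_le_sub_left (arctan_strictMono.monotone (div_le_div_of_nonneg_right h (abs_nonneg r))) _

theorem arccotProd_anti {a b a' b' : ℝ} (ha : a ≤ a') (hb : b ≤ b') :
    arccotProd a' b' ≤ arccotProd a b := by
  refine integral_mono
    (integrable_stdCauchy_of_bounded (π * π) (by fun_prop) (abs_arccotAbs_mul_le _ _))
    (integrable_stdCauchy_of_bounded (π * π) (by fun_prop) (abs_arccotAbs_mul_le _ _)) fun r => ?_
  exact mul_le_mul (arccotAbs_anti ha r) (arccotAbs_anti hb r) (arccotAbs_nonneg _ _)
    (arccotAbs_nonneg _ _)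

theorem errZ_lower : 0.019185 ≤ errZ 2.77935 2.77935 := by
  rw [errZ_eq (by norm_num) (by norm_num)]
  have h1 := arccotProd_diag_le (n := 10) (by decide) (t := 2.77935) (by norm_num)
  have h2 := le_arccotProd_zero (s := 2.77935 + 2.77935) (by norm_num)
  have h3 : log (2.77935 + 2.77935) = log 5 + log 1.11174 := by
    rw [← log_mul] <;> norm_num
  have h4 := (log_div_bounds 1.11174 (0.11174 / 2.11174) 3 (by norm_num) (by norm_num)
    (by norm_num)).1
  have h5 := log_five_gt_d9
  have h6 : 1.71536 ≤ log (2.77935 + 2.77935) := by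
    rw [h3]
    norm_num [Finset.sum_range_succ] at h4 ⊢
    linarith
  have h7 : 0.91715 ≤ dilogTaylor 10 ((2.77935 - 1) / (2.77935 + 1)) +
      (logTail 1 (2.77935 + 2.77935) + logTail 3 (2.77935 + 2.77935) +
        logTail 5 (2.77935 + 2.77935)) := by
    simp only [logTail]
    generalize log (2.77935 + 2.77935) = x at h6
    norm_num [dilogTaylor, Finset.sum_range_succ] at h6 ⊢
    linarith
  have h8 : π ^ 2 < 3.141593 ^ 2 := by
    have := pi_lt_d6; have := pi_pos; gcongr
  -- The term π²/12 contributes exactly −1/6, so only 2 · 0.91715/π² needs a bound on π.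
  have h9 : -(2 / π ^ 2) * (π ^ 2 / 12 - 0.91715) ≤ -(2 / π ^ 2) *
      (arccotProd 2.77935 2.77935 - arccotProd (2.77935 + 2.77935) 0) :=
    mul_le_mul_of_nonpos_left (by linarith) (by rw [neg_nonpos]; positivity)
  refine le_trans ?_ h9
  rw [show -(2 / π ^ 2) * (π ^ 2 / 12 - 0.91715) = 2 * 0.91715 / π ^ 2 - 1 / 6 by
    field_simp; ring, le_sub_iff_add_le, le_div_iff₀ (by positivity)]
  norm_num at h8 ⊢
  linarith

/-- The root is only known to lie in an interval; as P decreases in each argument, its two values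
are bounded at opposite endpoints. -/
theorem errZ_upper {t : ℝ} (h1 : 2.779345 ≤ t) (h2 : t ≤ 2.779355) : errZ t t ≤ 0.019195 := by
  have ht : 2 ≤ t := by norm_num at h1; linarith
  rw [errZ_eq (by linarith) (by linarith)]
  have h3 := (le_arccotProd_diag (n := 9) (by decide) (t := 2.779355) (by norm_num)).trans
    (arccotProd_anti h2 h2)
  have h4 := (arccotProd_anti (add_le_add h1 h1) (le_refl 0)).trans
    (arccotProd_zero_le (s := 2.779345 + 2.779345) (by norm_num))
  have h5 : log (2.779345 + 2.779345) = log 5 + log 1.111738 := by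
    rw [← log_mul] <;> norm_num
  have h6 := (log_div_bounds 1.111738 (0.111738 / 2.111738) 3 (by norm_num) (by norm_num)
    (by norm_num)).2
  have h7 := log_five_lt_d9
  have h8 : log (2.779345 + 2.779345) ≤ 1.71537 := by
    rw [h5]
    norm_num [Finset.sum_range_succ] at h6 ⊢
    linarith
  have h9 : dilogTaylor 9 ((2.779355 - 1) / (2.779355 + 1)) +
      (logTail 1 (2.779345 + 2.779345) + logTail 3 (2.779345 + 2.779345) +
        logTail 5 (2.779345 + 2.779345) + 1.1 * logTail 7 (2.779345 + 2.779345)) ≤ 0.91718 := by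
    simp only [logTail]
    generalize log (2.779345 + 2.779345) = x at h8
    norm_num [dilogTaylor, Finset.sum_range_succ] at h8 ⊢
    linarith
  have h10 : 3.141592 ^ 2 < π ^ 2 := by
    have := pi_gt_d6; gcongr
  have h11 : -(2 / π ^ 2) * (arccotProd t t - arccotProd (t + t) 0) ≤
      -(2 / π ^ 2) * (π ^ 2 / 12 - 0.91718) :=
    mul_le_mul_of_nonpos_left (by linarith) (by rw [neg_nonpos]; positivity)
  refine h11.trans ?_
  rw [show -(2 / π ^ 2) * (π ^ 2 / 12 - 0.91718) = 2 * 0.91718 / π ^ 2 - 1 / 6 by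
    field_simp; ring, sub_le_iff_le_add, div_le_iff₀ (by positivity)]
  norm_num at h10 ⊢
  linarith

/-! ### Characteristic function and joint law -/

theorem fourier_exp_neg_abs_aux (w : ℝ) :
    Integrable (fun x : ℝ => Complex.exp (↑(-2 * π * x * w) * Complex.I) *
      (rexp (-(2 * π * |x|)) : ℂ)) ∧
    ∫ x : ℝ, Complex.exp (↑(-2 * π * x * w) * Complex.I) * (rexp (-(2 * π * |x|)) : ℂ) =
      ((π⁻¹ * (1 + w ^ 2)⁻¹ : ℝ) : ℂ) := by
  set f : ℝ → ℂ := fun x => Complex.exp (↑(-2 * π * x * w) * Complex.I) *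
      (rexp (-(2 * π * |x|)) : ℂ) with hf
  set a : ℂ := -(2 * π) * (1 + w * Complex.I) with ha
  set b : ℂ := (2 * π) * (1 - w * Complex.I) with hb
  have ha' : a.re < 0 := by simp [ha, pi_pos]
  have hb' : 0 < b.re := by simp [hb, pi_pos]
  have h1 : EqOn (fun x : ℝ => Complex.exp (a * x)) f (Ioi 0) := by
    intro x hx
    simp only [hf, ha]
    rw [abs_of_pos hx, Complex.ofReal_exp, ← Complex.exp_add]
    congr 1
    push_cast
    ring
  have h2 : EqOn (fun x : ℝ => Complex.exp (b * x)) f (Iic 0) := by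
    intro x hx
    simp only [hf, hb]
    rw [abs_of_nonpos hx, Complex.ofReal_exp, ← Complex.exp_add]
    congr 1
    push_cast
    ring
  have i1 : IntegrableOn f (Ioi 0) :=
    (integrableOn_exp_mul_complex_Ioi ha' 0).congr_fun h1 measurableSet_Ioi
  have i2 : IntegrableOn f (Iic 0) :=
    (integrableOn_exp_mul_complex_Iic hb' 0).congr_fun h2 measurableSet_Iic
  refine ⟨?_, ?_⟩
  · rw [← integrableOn_univ, ← Iic_union_Ioi (a := (0 : ℝ))]
    exact i2.union i1
  · rw [← intervalIntegral.integral_Iic_add_Ioi i2 i1,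
      ← setIntegral_congr_fun measurableSet_Ioi h1, ← setIntegral_congr_fun measurableSet_Iic h2,
      integral_exp_mul_complex_Ioi ha', integral_exp_mul_complex_Iic hb']
    have e1 : (1 + w * Complex.I : ℂ) ≠ 0 := fun h => by simpa using congrArg Complex.re h
    have e2 : (1 - w * Complex.I : ℂ) ≠ 0 := fun h => by simpa using congrArg Complex.re h
    have e3 : (1 + w ^ 2 : ℂ) = (1 + w * Complex.I) * (1 - w * Complex.I) := by
      ring_nf
      simp
    have e4 : (π : ℂ) ≠ 0 := by exact_mod_cast pi_ne_zero
    push_cast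
    rw [e3, ha, hb]
    simp only [mul_zero, Complex.exp_zero]
    field_simp
    ring

/-- The Cauchy density is the Fourier transform of exp(−2π|x|), so Fourier inversion recovers the
exponential. Evaluation at t/(2π) accounts for the 2π in the Fourier kernel. -/
theorem charFun_stdCauchy (t : ℝ) : charFun stdCauchy t = (rexp (-|t|) : ℂ) := by
  let f : ℝ → ℂ := fun x => (rexp (-(2 * π * |x|)) : ℂ)
  have hF : FourierTransform.fourier f = fun w : ℝ => ((π⁻¹ * (1 + w ^ 2)⁻¹ : ℝ) : ℂ) := by
    ext w
    rw [fourier_real_eq_integral_exp_smul]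
    exact (fourier_exp_neg_abs_aux w).2
  have hf : Integrable f := by simpa [f] using (fourier_exp_neg_abs_aux 0).1
  have hFi : Integrable (FourierTransform.fourier f) := by
    rw [hF]; exact (integrable_inv_one_add_sq.const_mul _).ofReal
  have hc : Continuous f := by fun_prop
  have key := congrFun (hc.fourierInv_fourier_eq hf hFi) (t / (2 * π))
  rw [hF, fourierInv_eq'] at key
  rw [charFun_apply_real, integral_stdCauchy]
  have h2 : f (t / (2 * π)) = (rexp (-|t|) : ℂ) := by
    simp only [f]
    rw [abs_div, abs_of_pos (by positivity : 0 < 2 * π)]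
    congr 3
    field_simp
  rw [← h2, ← key]
  congr 1
  ext x
  rw [smul_eq_mul, Complex.real_smul, mul_comm]
  congr 3
  simp
  have e4 : (π : ℂ) ≠ 0 := by exact_mod_cast pi_ne_zero
  field_simp

theorem integral_exp_stdCauchy (t : ℝ) :
    ∫ r : ℝ, Complex.exp (↑(t * r) * Complex.I) ∂stdCauchy = (rexp (-|t|) : ℂ) := by
  rw [← charFun_stdCauchy, charFun_apply_real]
  push_cast
  rfl

/-- The joint law of two linear combinations of independent Cauchy variables depends only on
the function `(α, β) ↦ ∑ |α uᵢ + β vᵢ|`. -/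
theorem map_pi_stdCauchy_eq {D : ℕ} (u v : Fin D → ℝ) {a b c : ℝ} (ha : 0 ≤ a) (hb : 0 ≤ b)
    (hc : 0 ≤ c)
    (h : ∀ α β : ℝ, ∑ i, |α * u i + β * v i| = a * |α| + b * |β| + c * |α + β|) :
    (Measure.pi fun _ : Fin D => stdCauchy).map
        (fun r => ((∑ i, u i * r i, ∑ i, v i * r i) : ℝ × ℝ)) =
      (stdCauchy.prod (stdCauchy.prod stdCauchy)).map
        (fun p => ((a * p.2.1 + c * p.1, b * p.2.2 + c * p.1) : ℝ × ℝ)) := by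
  have m1 : Measurable fun r : Fin D → ℝ => ((∑ i, u i * r i, ∑ i, v i * r i) : ℝ × ℝ) := by
    fun_prop
  have m2 : Measurable fun p : ℝ × ℝ × ℝ =>
      ((a * p.2.1 + c * p.1, b * p.2.2 + c * p.1) : ℝ × ℝ) := by fun_prop
  have := Measure.isProbabilityMeasure_map (μ := Measure.pi fun _ : Fin D => stdCauchy)
    m1.aemeasurable
  have := Measure.isProbabilityMeasure_map (μ := stdCauchy.prod (stdCauchy.prod stdCauchy))
    m2.aemeasurable
  refine Measure.ext_of_charFunDual (funext fun L => ?_)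
  set α := L (1, 0) with hα
  set β := L (0, 1) with hβ
  have hL : ∀ x y : ℝ, L (x, y) = α * x + β * y := by
    intro x y
    have : ((x, y) : ℝ × ℝ) = x • (1, 0) + y • (0, 1) := by ext <;> simp
    rw [this, map_add, map_smul, map_smul, smul_eq_mul, smul_eq_mul, mul_comm x, mul_comm y]
  have hLc : Continuous fun x : ℝ × ℝ => Complex.exp ((L x : ℂ) * Complex.I) := by fun_prop
  rw [charFunDual_apply, charFunDual_apply,
    integral_map m1.aemeasurable hLc.aestronglyMeasurable,
    integral_map m2.aemeasurable hLc.aestronglyMeasurable]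
  have e1 : ∀ r : Fin D → ℝ,
      Complex.exp ((L (∑ i, u i * r i, ∑ i, v i * r i) : ℂ) * Complex.I) =
        ∏ i, Complex.exp (↑((α * u i + β * v i) * r i) * Complex.I) := by
    intro r
    rw [hL, ← Complex.exp_sum, ← Finset.sum_mul, ← Complex.ofReal_sum, Finset.mul_sum,
      Finset.mul_sum, ← Finset.sum_add_distrib]
    congr 4
    ext i
    ring
  have e2 : ∀ p : ℝ × ℝ × ℝ,
      Complex.exp ((L (a * p.2.1 + c * p.1, b * p.2.2 + c * p.1) : ℂ) * Complex.I) =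
        Complex.exp (↑((c * (α + β)) * p.1) * Complex.I) *
        (Complex.exp (↑((a * α) * p.2.1) * Complex.I) *
          Complex.exp (↑((b * β) * p.2.2) * Complex.I)) := by
    intro p
    rw [hL, ← Complex.exp_add, ← Complex.exp_add]
    congr 1
    push_cast
    ring
  simp only [e1, e2]
  rw [integral_fintype_prod_eq_prod
      (f := fun i x => Complex.exp (↑((α * u i + β * v i) * x) * Complex.I)),
    integral_prod_mul (fun x : ℝ => Complex.exp (↑((c * (α + β)) * x) * Complex.I))
      (fun q : ℝ × ℝ => Complex.exp (↑((a * α) * q.1) * Complex.I) *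
          Complex.exp (↑((b * β) * q.2) * Complex.I)),
    integral_prod_mul (fun x : ℝ => Complex.exp (↑((a * α) * x) * Complex.I))
      (fun x : ℝ => Complex.exp (↑((b * β) * x) * Complex.I))]
  simp only [integral_exp_stdCauchy]
  rw [← Complex.ofReal_prod, ← Real.exp_sum, Finset.sum_neg_distrib, h α β, abs_mul, abs_mul,
    abs_mul, abs_of_nonneg ha, abs_of_nonneg hb, abs_of_nonneg hc, ← Complex.ofReal_mul,
    ← Complex.ofReal_mul, ← Real.exp_add, ← Real.exp_add]
  congr 2
  ring

/-! ### Sign probabilities -/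

/-- The sign of a real number, as a real number. -/
noncomputable def realSign (x : ℝ) : ℝ := if 0 < x then 1 else if x < 0 then -1 else 0

theorem realSign_of_pos {x : ℝ} (h : 0 < x) : realSign x = 1 := if_pos h

theorem realSign_of_neg {x : ℝ} (h : x < 0) : realSign x = -1 := by
  rw [realSign, if_neg h.not_gt, if_pos h]

theorem realSign_zero : realSign 0 = 0 := by simp [realSign]

theorem realSign_mul_pos {c : ℝ} (hc : 0 < c) (x : ℝ) : realSign (c * x) = realSign x := by
  rcases lt_trichotomy x 0 with h | rfl | h
  · rw [realSign_of_neg h, realSign_of_neg (mul_neg_of_pos_of_neg hc h)]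
  · rw [mul_zero]
  · rw [realSign_of_pos h, realSign_of_pos (mul_pos hc h)]

theorem abs_realSign_le (x : ℝ) : |realSign x| ≤ 1 := by
  unfold realSign; split_ifs <;> simp

@[fun_prop]
theorem measurable_realSign : Measurable realSign :=
  Measurable.ite measurableSet_Ioi measurable_const
    (Measurable.ite measurableSet_Iio measurable_const measurable_const)

theorem sign_ne_iff (x y : ℝ) :
    SignType.sign x ≠ SignType.sign y ↔ realSign x ≠ realSign y := by
  have h : ∀ x : ℝ, realSign x = ((SignType.sign x : SignType) : ℝ) := by
    intro x
    rcases lt_trichotomy x 0 with h | rfl | h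
    · rw [realSign_of_neg h, sign_neg h]; rfl
    · simp [realSign_zero]
    · rw [realSign_of_pos h, sign_pos h]; rfl
  rw [h, h, not_iff_not]
  generalize SignType.sign x = s
  generalize SignType.sign y = t
  refine ⟨fun h => by rw [h], fun h => ?_⟩
  cases s <;> cases t <;> first | rfl | (exfalso; norm_num at h)

theorem measurableSet_sign_ne :
    MeasurableSet {p : ℝ × ℝ | SignType.sign p.1 ≠ SignType.sign p.2} := by
  simp only [sign_ne_iff]
  exact (measurableSet_eq_fun (by fun_prop) (by fun_prop)).compl

theorem stdCauchy_real {s : Set ℝ} (hs : MeasurableSet s) :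
    stdCauchy.real s = π⁻¹ * ∫ x in s, (1 + x ^ 2)⁻¹ := by
  rw [← integral_indicator_one hs, integral_stdCauchy, ← integral_const_mul,
    ← integral_indicator hs]
  congr 1
  ext x
  by_cases hx : x ∈ s <;> simp [hx]

theorem integral_realSign_add (x : ℝ) :
    ∫ r, realSign (r + x) ∂stdCauchy = 2 / π * arctan x := by
  have h : ∀ r, realSign (r + x) =
      (Ioi (-x)).indicator 1 r - (Iio (-x)).indicator (1 : ℝ → ℝ) r := by
    intro r
    rcases lt_trichotomy (r + x) 0 with h | h | h
    · have h' : r < -x := by linarith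
      rw [realSign_of_neg h]; simp [h', h'.le]
    · have h' : r = -x := by linarith
      rw [h, realSign_zero]; simp [h']
    · have h' : -x < r := by linarith
      rw [realSign_of_pos h]; simp [h', h'.le]
  simp only [h]
  rw [integral_sub ((integrable_indicator_iff measurableSet_Ioi).2 (integrable_const 1).integrableOn)
    ((integrable_indicator_iff measurableSet_Iio).2 (integrable_const 1).integrableOn),
    integral_indicator_one measurableSet_Ioi, integral_indicator_one measurableSet_Iio,
    stdCauchy_real measurableSet_Ioi, stdCauchy_real measurableSet_Iio,
    integral_Ioi_inv_one_add_sq, ← integral_Iic_eq_integral_Iio, integral_Iic_inv_one_add_sq,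
    arctan_neg]
  field_simp
  ring

/-- Dividing by a > 0 reduces to a shifted sign; for a = 0 the sign is deterministic, which matches
the convention arctan(|r|/0) = π/2. -/
theorem integral_realSign_mul_add {a c : ℝ} (ha : 0 ≤ a) (hc : 0 < c) {r : ℝ} (hr : r ≠ 0) :
    ∫ x, realSign (a * x + c * r) ∂stdCauchy =
      2 / π * realSign r * arctanDiv |r| (a / c) := by
  rcases ha.eq_or_lt with rfl | ha
  · simp [realSign_mul_pos hc, arctanDiv, hr]
    field_simp
  · have h1 : ∀ x, realSign (a * x + c * r) = realSign (x + c * r / a) := by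
      intro x
      rw [← realSign_mul_pos ha (x + c * r / a)]
      congr 1
      field_simp
    simp only [h1]
    rw [integral_realSign_add, arctanDiv, if_neg (by simp [ha.ne', hc.ne'])]
    rcases hr.lt_or_gt with h | h
    · rw [realSign_of_neg h, abs_of_neg h,
        show -r / (a / c) = -(c * r / a) by field_simp, arctan_neg]
      ring
    · rw [realSign_of_pos h, abs_of_pos h, show r / (a / c) = c * r / a by field_simp]
      ring

theorem ae_linear_ne_zero {a c : ℝ} (h : a ≠ 0 ∨ c ≠ 0) :
    ∀ᵐ p ∂(stdCauchy.prod stdCauchy), a * p.2 + c * p.1 ≠ 0 := by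
  by_cases ha : a = 0
  · have hc : c ≠ 0 := h.resolve_left (not_not.2 ha)
    filter_upwards [Measure.quasiMeasurePreserving_fst.ae (ae_stdCauchy_ne 0)] with p hp
    simp [ha, hc, hp]
  · have hm : MeasurableSet {p : ℝ × ℝ | a * p.2 + c * p.1 ≠ 0} :=
      (measurableSet_eq_fun (by fun_prop) measurable_const).compl
    rw [Measure.ae_prod_iff_ae_ae hm]
    refine Eventually.of_forall fun x => ?_
    filter_upwards [ae_stdCauchy_ne (-(c * x) / a)] with y hy h0
    refine hy ?_
    field_simp
    linarith

/-- The probability that two Cauchy combinations with a common part have different signs. -/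
theorem prob_sign_ne_eq {a b c : ℝ} (hac : a ≠ 0 ∨ c ≠ 0) (hbc : b ≠ 0 ∨ c ≠ 0) :
    (stdCauchy.prod (stdCauchy.prod stdCauchy)).real
      {p | SignType.sign (a * p.2.1 + c * p.1) ≠ SignType.sign (b * p.2.2 + c * p.1)} =
    1 / 2 - 1 / 2 * ∫ r, (∫ x, realSign (a * x + c * r) ∂stdCauchy) *
      (∫ x, realSign (b * x + c * r) ∂stdCauchy) ∂stdCauchy := by
  set μ := stdCauchy.prod (stdCauchy.prod stdCauchy) with hμ
  set S := {p : ℝ × ℝ × ℝ |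
    SignType.sign (a * p.2.1 + c * p.1) ≠ SignType.sign (b * p.2.2 + c * p.1)} with hS
  have hSm : MeasurableSet S := measurableSet_sign_ne.preimage
    (by fun_prop : Measurable fun p : ℝ × ℝ × ℝ =>
      ((a * p.2.1 + c * p.1, b * p.2.2 + c * p.1) : ℝ × ℝ))
  have n1 : ∀ᵐ p ∂μ, a * p.2.1 + c * p.1 ≠ 0 :=
    ((MeasurePreserving.id stdCauchy).prod
      measurePreserving_fst).quasiMeasurePreserving.ae (ae_linear_ne_zero hac)
  have n2 : ∀ᵐ p ∂μ, b * p.2.2 + c * p.1 ≠ 0 :=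
    ((MeasurePreserving.id stdCauchy).prod
      measurePreserving_snd).quasiMeasurePreserving.ae (ae_linear_ne_zero hbc)
  have hint : Integrable (fun p : ℝ × ℝ × ℝ =>
      realSign (a * p.2.1 + c * p.1) * realSign (b * p.2.2 + c * p.1)) μ := by
    refine Integrable.of_bound (by fun_prop : Measurable _).aestronglyMeasurable 1
      (Eventually.of_forall fun p => ?_)
    rw [norm_mul]
    exact mul_le_one₀ (abs_realSign_le _) (abs_nonneg _) (abs_realSign_le _)
  -- Ties have probability zero, and for signs ±1 the indicator of disagreement is (1 − product)/2.
  have e1 : μ.real S = ∫ p, (1 / 2 - 1 / 2 *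
      (realSign (a * p.2.1 + c * p.1) * realSign (b * p.2.2 + c * p.1))) ∂μ := by
    rw [← integral_indicator_one hSm]
    refine integral_congr_ae ?_
    filter_upwards [n1, n2] with p h1 h2
    have hp : p ∈ S ↔ realSign (a * p.2.1 + c * p.1) ≠ realSign (b * p.2.2 + c * p.1) :=
      sign_ne_iff _ _
    rcases h1.lt_or_gt with h1 | h1 <;> rcases h2.lt_or_gt with h2 | h2
    · rw [realSign_of_neg h1, realSign_of_neg h2] at *
      rw [indicator_of_notMem (by rw [hp]; simp)]; norm_num
    · rw [realSign_of_neg h1, realSign_of_pos h2] at *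
      rw [indicator_of_mem (by rw [hp]; norm_num)]; norm_num
    · rw [realSign_of_pos h1, realSign_of_neg h2] at *
      rw [indicator_of_mem (by rw [hp]; norm_num)]; norm_num
    · rw [realSign_of_pos h1, realSign_of_pos h2] at *
      rw [indicator_of_notMem (by rw [hp]; simp)]; norm_num
  rw [e1, integral_sub (integrable_const _) (hint.const_mul _), integral_const_mul,
    integral_prod _ hint]
  simp only [integral_const, probReal_univ, one_smul]
  congr 2
  refine integral_congr_ae (Eventually.of_forall fun r => ?_)
  exact integral_prod_mul (fun x => realSign (a * x + c * r)) (fun x => realSign (b * x + c * r))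

theorem prob_sign_ne_of_pos {a b c : ℝ} (ha : 0 ≤ a) (hb : 0 ≤ b) (hc : 0 < c) :
    (stdCauchy.prod (stdCauchy.prod stdCauchy)).real
      {p | SignType.sign (a * p.2.1 + c * p.1) ≠ SignType.sign (b * p.2.2 + c * p.1)} =
    1 / 2 - 2 / π ^ 2 * ∫ r, arctanDiv |r| (a / c) * arctanDiv |r| (b / c) ∂stdCauchy := by
  rw [prob_sign_ne_eq (Or.inr hc.ne') (Or.inr hc.ne'), ← integral_const_mul,
    ← integral_const_mul]
  congr 1
  refine integral_congr_ae ?_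
  filter_upwards [ae_stdCauchy_ne 0] with r hr
  rw [integral_realSign_mul_add ha hc hr, integral_realSign_mul_add hb hc hr]
  have : realSign r * realSign r = 1 := by
    rcases hr.lt_or_gt with h | h
    · rw [realSign_of_neg h]; norm_num
    · rw [realSign_of_pos h]; norm_num
  linear_combination (2 / π ^ 2) * arctanDiv |r| (a / c) * arctanDiv |r| (b / c) * this

theorem prob_sign_ne_of_zero {a b : ℝ} (ha : 0 < a) (hb : 0 < b) :
    (stdCauchy.prod (stdCauchy.prod stdCauchy)).real
      {p | SignType.sign (a * p.2.1 + 0 * p.1) ≠ SignType.sign (b * p.2.2 + 0 * p.1)} = 1 / 2 := by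
  rw [prob_sign_ne_eq (Or.inl ha.ne') (Or.inl hb.ne')]
  have h : ∫ x, realSign x ∂stdCauchy = 0 := by simpa using integral_realSign_add 0
  simp [realSign_mul_pos ha, h]

/-! ### The chi-square approximation as a Cauchy mean -/

theorem integral_arctanDiv_tan (s : ℝ) :
    ∫ t in (0 : ℝ)..(π / 2), arctanDiv (tan t) s =
      π / 2 * ∫ r, arctanDiv |r| s ∂stdCauchy := by
  have himg : arctan '' Ioi 0 = Ioo 0 (π / 2) := by
    ext y
    constructor
    · rintro ⟨x, hx, rfl⟩
      exact ⟨arctan_pos.2 hx, arctan_lt_pi_div_two x⟩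
    · intro hy
      exact ⟨tan y, tan_pos_of_pos_of_lt_pi_div_two hy.1 hy.2,
        arctan_tan (by linarith [hy.1, pi_pos]) hy.2⟩
  rw [intervalIntegral.integral_of_le (by positivity), integral_Ioc_eq_integral_Ioo, ← himg,
    integral_image_eq_integral_abs_deriv_smul measurableSet_Ioi
      (fun x _ => (hasDerivAt_arctan x).hasDerivWithinAt) arctan_injective.injOn,
    integral_stdCauchy_abs fun x => arctanDiv x s, ← integral_const_mul]
  congr 1
  ext x
  rw [tan_arctan, abs_of_nonneg (by positivity), smul_eq_mul]
  field_simp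

theorem arctanDiv_mul_mul {k : ℝ} (hk : 0 < k) (y x : ℝ) :
    arctanDiv (k * y) (k * x) = arctanDiv y x := by
  simp only [arctanDiv, mul_pos_iff_of_pos_left hk, mul_eq_zero, hk.ne', false_or,
    mul_div_mul_left _ _ hk.ne']

/-- For this similarity ρ/(2−2ρ) = c/(a+b). Rescaling both arguments of `arctanDiv` instead of
dividing also covers a = b = 0, that is ρ = 1. -/
theorem chiSqApprox2_eq {a b c : ℝ} (ha : 0 ≤ a) (hb : 0 ≤ b) (hc : 0 < c) :
    chiSqApprox2 (2 * c / (a + b + 2 * c)) =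
      1 / 2 - 1 / π * ∫ r, arctanDiv |r| (a / c + b / c) ∂stdCauchy := by
  have h : ∀ t, arctanDiv (2 * c / (a + b + 2 * c) * tan t) (2 - 2 * (2 * c / (a + b + 2 * c))) =
      arctanDiv (tan t) (a / c + b / c) := by
    intro t
    rw [← arctanDiv_mul_mul (show 0 < 2 * c / (a + b + 2 * c) by positivity) (tan t)]
    congr 1
    field_simp
    ring
  simp only [chiSqApprox2, h]
  rw [integral_arctanDiv_tan]
  field_simp

theorem chiSqApprox2_zero : chiSqApprox2 0 = 1 / 2 := by
  simp [chiSqApprox2, arctanDiv]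

/-! ### Binary data -/

section BinaryData

variable {D : ℕ} {w w' : Fin D → ℝ}

theorem IsBinaryData.sum_pos (hw : IsBinaryData w) : 0 < ∑ i, w i := by
  obtain ⟨i, hi⟩ := hw.2
  refine Finset.sum_pos' (fun j _ => ?_) ⟨i, Finset.mem_univ i, ?_⟩
  · rcases hw.1 j with h | h <;> simp [h]
  · rcases hw.1 i with h | h
    · exact absurd h hi
    · simp [h]

theorem IsBinaryData.normalizeData_pos_iff (hw : IsBinaryData w) (i : Fin D) :
    0 < normalizeData w i ↔ w i = 1 := by
  have h := hw.sum_pos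
  rcases hw.1 i with h0 | h0 <;> simp [normalizeData, h0, h]

theorem IsBinaryData.normalizeData_eq_zero_iff (hw : IsBinaryData w) (i : Fin D) :
    normalizeData w i = 0 ↔ w i = 0 := by
  simp [normalizeData, hw.sum_pos.ne']

theorem onlyFirstCount_normalizeData (hw : IsBinaryData w) (hw' : IsBinaryData w') :
    (onlyFirstCount (normalizeData w) (normalizeData w') : ℝ) = ∑ i, w i * (1 - w' i) := by
  classical
  have h : {i : Fin D | 0 < normalizeData w i ∧ normalizeData w' i = 0} =
      ↑(Finset.univ.filter fun i => w i = 1 ∧ w' i = 0) := by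
    ext i; simp [hw.normalizeData_pos_iff, hw'.normalizeData_eq_zero_iff]
  rw [onlyFirstCount, h, Set.ncard_coe_finset, Finset.card_filter, Nat.cast_sum]
  refine Finset.sum_congr rfl fun i _ => ?_
  rcases hw.1 i with h | h <;> rcases hw'.1 i with h' | h' <;> simp [h, h']

theorem bothCount_normalizeData (hw : IsBinaryData w) (hw' : IsBinaryData w') :
    (bothCount (normalizeData w) (normalizeData w') : ℝ) = ∑ i, w i * w' i := by
  classical
  have h : {i : Fin D | 0 < normalizeData w i ∧ 0 < normalizeData w' i} =
      ↑(Finset.univ.filter fun i => w i = 1 ∧ w' i = 1) := by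
    ext i; simp [hw.normalizeData_pos_iff, hw'.normalizeData_pos_iff]
  rw [bothCount, h, Set.ncard_coe_finset, Finset.card_filter, Nat.cast_sum]
  refine Finset.sum_congr rfl fun i _ => ?_
  rcases hw.1 i with h | h <;> rcases hw'.1 i with h' | h' <;> simp [h, h']

theorem chiSqSim_normalizeData (hw : IsBinaryData w) (hw' : IsBinaryData w') :
    chiSqSim (normalizeData w) (normalizeData w') =
      2 * (∑ i, w i * w' i) / (∑ i, w i + ∑ i, w' i) := by
  have h := hw.sum_pos
  have h' := hw'.sum_pos
  rw [chiSqSim, Finset.mul_sum, Finset.sum_div]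
  refine Finset.sum_congr rfl fun i _ => ?_
  simp only [normalizeData]
  rcases hw.1 i with e | e <;> rcases hw'.1 i with e' | e' <;> simp only [e, e'] <;> field_simp <;>
    ring

theorem sign_sum_normalizeData (hw : IsBinaryData w) (r : Fin D → ℝ) :
    SignType.sign (∑ i, normalizeData w i * r i) = SignType.sign (∑ i, w i * r i) := by
  have h : ∑ i, w i * r i = (∑ i, w i) * ∑ i, normalizeData w i * r i := by
    rw [Finset.mul_sum]
    refine Finset.sum_congr rfl fun i _ => ?_
    have := hw.sum_pos.ne'
    simp only [normalizeData]
    field_simp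
  rw [h, sign_mul, sign_pos hw.sum_pos, one_mul]

theorem collisionProb_normalizeData (hw : IsBinaryData w) (hw' : IsBinaryData w') :
    collisionProb (normalizeData w) (normalizeData w') =
      (stdCauchy.prod (stdCauchy.prod stdCauchy)).real
        {p | SignType.sign ((∑ i, w i * (1 - w' i)) * p.2.1 + (∑ i, w i * w' i) * p.1) ≠
          SignType.sign ((∑ i, w' i * (1 - w i)) * p.2.2 + (∑ i, w i * w' i) * p.1)} := by
  have n : ∀ {w w' : Fin D → ℝ}, IsBinaryData w → IsBinaryData w' →
      0 ≤ ∑ i, w i * (1 - w' i) := fun hw hw' => Finset.sum_nonneg fun i _ => by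
    rcases hw.1 i with e | e <;> rcases hw'.1 i with e' | e' <;> simp [e, e']
  have nc : 0 ≤ ∑ i, w i * w' i := Finset.sum_nonneg fun i _ => by
    rcases hw.1 i with e | e <;> rcases hw'.1 i with e' | e' <;> simp [e, e']
  -- For 0/1 entries each |α wᵢ + β w'ᵢ| is 0, |α|, |β| or |α+β|, so the sum only sees the three
  -- counts.
  have hlaw := map_pi_stdCauchy_eq w w' (n hw hw') (n hw' hw) nc fun α β => by
    rw [Finset.sum_mul, Finset.sum_mul, Finset.sum_mul, ← Finset.sum_add_distrib,
      ← Finset.sum_add_distrib]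
    refine Finset.sum_congr rfl fun i _ => ?_
    rcases hw.1 i with e | e <;> rcases hw'.1 i with e' | e' <;> simp [e, e']
  have h1 : (Measure.pi fun _ : Fin D => stdCauchy).real
      {r | SignType.sign (∑ i, w i * r i) ≠ SignType.sign (∑ i, w' i * r i)} =
      ((Measure.pi fun _ : Fin D => stdCauchy).map
        (fun r => ((∑ i, w i * r i, ∑ i, w' i * r i) : ℝ × ℝ))).real
        {p | SignType.sign p.1 ≠ SignType.sign p.2} := by
    rw [map_measureReal_apply (by fun_prop) measurableSet_sign_ne]; rfl
  simp only [collisionProb, sign_sum_normalizeData hw, sign_sum_normalizeData hw']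
  rw [h1, hlaw, map_measureReal_apply (by fun_prop) measurableSet_sign_ne]
  rfl

theorem sum_eq_only_add_both (w w' : Fin D → ℝ) :
    ∑ i, w i = ∑ i, w i * (1 - w' i) + ∑ i, w i * w' i := by
  rw [← Finset.sum_add_distrib]
  refine Finset.sum_congr rfl fun i _ => ?_
  ring

theorem collisionErr_eq_errZ (hw : IsBinaryData w) (hw' : IsBinaryData w')
    (hc : bothCount (normalizeData w) (normalizeData w') ≠ 0) :
    collisionErr (normalizeData w) (normalizeData w') =
      errZ ((onlyFirstCount (normalizeData w) (normalizeData w') : ℝ) /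
          (bothCount (normalizeData w) (normalizeData w') : ℝ))
        ((onlyFirstCount (normalizeData w') (normalizeData w) : ℝ) /
          (bothCount (normalizeData w) (normalizeData w') : ℝ)) := by
  have hc' : (0 : ℝ) < bothCount (normalizeData w) (normalizeData w') := by
    exact_mod_cast Nat.pos_of_ne_zero hc
  have ha : (0 : ℝ) ≤ onlyFirstCount (normalizeData w) (normalizeData w') := Nat.cast_nonneg _
  have hb : (0 : ℝ) ≤ onlyFirstCount (normalizeData w') (normalizeData w) := Nat.cast_nonneg _
  rw [collisionErr, collisionProb_normalizeData hw hw', chiSqSim_normalizeData hw hw',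
    sum_eq_only_add_both w w', sum_eq_only_add_both w' w]
  simp only [mul_comm (w' _) (w _)]
  rw [onlyFirstCount_normalizeData hw hw'] at *
  rw [onlyFirstCount_normalizeData hw' hw] at *
  rw [bothCount_normalizeData hw hw'] at *
  set a := ∑ i, w i * (1 - w' i)
  set b := ∑ i, w' i * (1 - w i)
  set c := ∑ i, w i * w' i
  rw [prob_sign_ne_of_pos ha hb hc', show a + c + (b + c) = a + b + 2 * c by ring,
    chiSqApprox2_eq ha hb hc', errZ]
  ring

/-- Disjoint supports make the two signs independent and symmetric, so the probability is 1/2, which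
is also the approximation at ρ = 0. -/
theorem collisionErr_of_disjoint (hw : IsBinaryData w) (hw' : IsBinaryData w')
    (hc : bothCount (normalizeData w) (normalizeData w') = 0) :
    collisionErr (normalizeData w) (normalizeData w') = 0 := by
  have hc' : ∑ i, w i * w' i = 0 := by rw [← bothCount_normalizeData hw hw', hc, Nat.cast_zero]
  have hc'' : ∑ i, w' i * w i = 0 := by simpa only [mul_comm] using hc'
  have ha := hw.sum_pos
  have hb := hw'.sum_pos
  rw [sum_eq_only_add_both w w', hc', add_zero] at ha
  rw [sum_eq_only_add_both w' w, hc'', add_zero] at hb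
  rw [collisionErr, collisionProb_normalizeData hw hw', chiSqSim_normalizeData hw hw', hc',
    prob_sign_ne_of_zero ha hb]
  simp [chiSqApprox2_zero]

end BinaryData

theorem mainTheorem3 :
    ∃ t : ℝ,
      -- `t` is the unique positive root of the equation
      (0 < t ∧ 1 / (t ^ 2 - 1) * log (2 * t / (1 + t)) - log (2 * t) / ((2 * t) ^ 2 - 1) = 0) ∧
      (∀ s : ℝ, 0 < s →
        1 / (s ^ 2 - 1) * log (2 * s / (1 + s)) - log (2 * s) / ((2 * s) ^ 2 - 1) = 0 → s = t) ∧
      -- numerical values, rounded to five decimals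
      |t - 2.77935| ≤ 0.000005 ∧
      |errZ t t - 0.01919| ≤ 0.000005 ∧
      -- integral formula for the maximum
      errZ t t = ∫ r in Ioi (0 : ℝ),
        (-(2 / π ^ 2) * arctan (r / t) ^ 2 + 1 / π * arctan (r / (2 * t)))
          * (2 / π * (1 / (1 + r ^ 2))) ∧
      -- bounds for all parameters; the upper one is attained at `t₁ = t₂ = t`
      (∀ t₁ t₂ : ℝ, 0 ≤ t₁ → 0 ≤ t₂ → 0 ≤ errZ t₁ t₂ ∧ errZ t₁ t₂ ≤ errZ t t) ∧
      -- the error for binary data, expressed through `Z` and bounded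
      (∀ (D : ℕ) (w w' : Fin D → ℝ), IsBinaryData w → IsBinaryData w' →
        ∀ u v : Fin D → ℝ, u = normalizeData w → v = normalizeData w' →
          (bothCount u v ≠ 0 →
            collisionErr u v = errZ ((onlyFirstCount u v : ℝ) / (bothCount u v : ℝ))
              ((onlyFirstCount v u : ℝ) / (bothCount u v : ℝ))) ∧
          0 ≤ collisionErr u v ∧ collisionErr u v ≤ errZ t t) := by
  obtain ⟨t, hlo, hhi, h0⟩ := exists_critNum_zero
  have h2 : 2 ≤ t := by norm_num at hlo; linarith
  have ht : 0 < t := by linarith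
  have hZ : ∀ t₁ t₂ : ℝ, 0 ≤ t₁ → 0 ≤ t₂ → 0 ≤ errZ t₁ t₂ ∧ errZ t₁ t₂ ≤ errZ t t :=
    fun t₁ t₂ h₁ h₂ => ⟨(errZ_bounds h₁ h₂).1,
      (errZ_bounds h₁ h₂).2.trans (errZ_diag_le h2 h0 (by positivity))⟩
  refine ⟨t, ⟨ht, critFun_root h2 h0⟩, fun s hs h => eq_root_of_critFun_eq_zero h2 h0 hs h,
    ?_, ?_, errZ_diag_eq_integral ht, hZ, ?_⟩
  · rw [abs_le]
    constructor <;> norm_num at hlo hhi ⊢ <;> linarith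
  -- Maximality lets the lower bound be evaluated at the decimal 2.77935 instead of at the unknown
  -- root.
  · have h3 := errZ_lower.trans (errZ_diag_le h2 h0 (by norm_num))
    have h4 := errZ_upper hlo hhi
    rw [abs_le]
    constructor <;> norm_num at h3 h4 ⊢ <;> linarith
  · rintro D w w' hw hw' u v rfl rfl
    refine ⟨collisionErr_eq_errZ hw hw', ?_⟩
    rcases eq_or_ne (bothCount (normalizeData w) (normalizeData w')) 0 with hc | hc
    · rw [collisionErr_of_disjoint hw hw' hc]
      exact ⟨le_rfl, (hZ t t ht.le ht.le).1⟩
    · rw [collisionErr_eq_errZ hw hw' hc]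
      exact hZ _ _ (by positivity) (by positivity)
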